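/- Let $d\ge 1$ and $n\ne d$ be integers ($n \geq d+1$ being the non-trivial case), let $\beta_1,\dots,\beta_n>-1$, and let $X_1,\dots,X_n$ be independent random points in $\mathbb{R}^d$ such that $X_i$ has the beta density $$f_{d,\beta_i}(x)=c_{d,\beta_i}(1-|x|^2)^{\beta_i}\ \ (|x|\le 1),\qquad f_{d,\beta_i}(x)=0\ \ (|x|>1),\qquad c_{m,\beta}=\frac{\Gamma(\frac m2+\beta+1)}{\pi^{m/2}\,\Gamma(\beta+1)}.$$ Let $P=\mathrm{conv}(X_1,\dots,X_n)$. For real $a>-1$ and $b\ge -1$ put $$T_{a,b}^{d-1,d}(P)=\sum_{F\in\mathcal F_{d-1}(P)}\mathrm{dist}(\mathrm{aff}\,F,0)^a\,\mathrm{Vol}_{d-1}(F)^b ,$$ where $\mathcal F_{d-1}(P)$ is the set of $(d-1)$-dimensional faces of $P$ and $\mathrm{aff}\,F$ is the affine hull of $F$. Then $T_{a,b}^{d-1,d}(P)$ is integrable and $$\mathbb{E}\,T_{a,b}^{d-1,d}(P)=d!\,\kappa_d\sum_{I}\frac{\prod_{i\in I}c_{d,\beta_i}}{\prod_{i\in I}c_{d-1,\beta_i}}\;\mathbb{E}\big(\Delta_I\big)^{b+1}\int_{-1}^{1}|h|^a(1-h^2)^{\sum_{i\in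 I}\beta_i+\frac{d-1}{2}(d+b+1)}\prod_{k\notin I}F_{\beta_k+\frac{d-1}{2}}(h)\,dh ,$$ where the sum is over all $d$-element subsets $I\subset\{1,\dots,n\}$; $\kappa_d$ is the volume of the unit ball of $\mathbb{R}^d$; $F_\beta(h)=c_{1,\beta}\int_{-1}^h(1-x^2)^\beta\,dx$; and $\Delta_I=\mathrm{Vol}_{d-1}(\mathrm{conv}(Y_i : i\in I))$ for independent points $Y_i$, $i\in I$, in $\mathbb{R}^{d-1}$ such that $Y_i$ has the density $f_{d-1,\beta_i}$. -/

import Mathlib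

open MeasureTheory ProbabilityTheory

noncomputable section

/-- The normalising constant `c_{d,β} = Γ(d/2 + β + 1) / (π^{d/2} Γ(β + 1))`. -/
def betaConst (d : ℕ) (β : ℝ) : ℝ :=
  Real.Gamma ((d : ℝ) / 2 + β + 1) / (Real.pi ^ ((d : ℝ) / 2) * Real.Gamma (β + 1))

open scoped Classical in
/-- The beta density `f_{d,β}(x) = c_{d,β} (1 - |x|²)^β` for `|x| ≤ 1`, and `0` elsewhere. -/
def betaDensity (d : ℕ) (β : ℝ) (x : EuclideanSpace ℝ (Fin d)) : ℝ :=
  if ‖x‖ ≤ 1 then betaConst d β * (1 - ‖x‖ ^ 2) ^ β else 0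

/-- The beta distribution on `ℝ^d`. For `d = 0` it is the unit mass at the only point. -/
def betaDistribution (d : ℕ) (β : ℝ) : Measure (EuclideanSpace ℝ (Fin d)) :=
  volume.withDensity (fun x => ENNReal.ofReal (betaDensity d β x))

/-- `F_β(h) = c_{1,β} ∫_{-1}^h (1 - x²)^β dx`. -/
def betaCDF (β h : ℝ) : ℝ :=
  betaConst 1 β * ∫ x in (-1 : ℝ)..h, (1 - x ^ 2) ^ β

/-- `κ_d`, the volume of the unit ball of `ℝ^d`. -/
def unitBallVolume (d : ℕ) : ℝ :=
  (volume : Measure (EuclideanSpace ℝ (Fin d))).real (Metric.ball 0 1)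

/-- The (nonempty) `k`-dimensional faces of a polytope `P`: the sets of maximisers over `P` of a
linear functional, whose affine hull has dimension `k`. -/
def polytopeFaces {d : ℕ} (k : ℕ) (P : Set (EuclideanSpace ℝ (Fin d))) :
    Set (Set (EuclideanSpace ℝ (Fin d))) :=
  {F | F.Nonempty ∧ IsExposed ℝ P F ∧ Module.finrank ℝ (vectorSpan ℝ F) = k}

/-- Wieacker's functional `T_{a,b}^{k,d}(P)`: the sum over the `k`-faces `F` of `P` of the `a`-th
power of the distance from the origin to the affine hull of `F`, times the `b`-th power of the
`k`-dimensional volume of `F`. -/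
def wieackerT {d : ℕ} (a b : ℝ) (k : ℕ) (P : Set (EuclideanSpace ℝ (Fin d))) : ℝ :=
  ∑ᶠ F ∈ polytopeFaces k P,
    Metric.infDist (0 : EuclideanSpace ℝ (Fin d)) (affineSpan ℝ F : Set (EuclideanSpace ℝ (Fin d))) ^ a
      * (Measure.euclideanHausdorffMeasure k).real F ^ b

/-- The `s`-th moment `𝔼 (Vol_m (conv (Y_i : i)))^s`, where the points `Y_i` of `ℝ^m` are
independent and `Y_i` has the beta density `f_{m,γ_i}`. -/
def betaVolumeMoment {ι : Type*} [Fintype ι] (m : ℕ) (γ : ι → ℝ) (s : ℝ) : ℝ :=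
  ∫ y : ι → EuclideanSpace ℝ (Fin m),
    (volume : Measure (EuclideanSpace ℝ (Fin m))).real (convexHull ℝ (Set.range y)) ^ s
    ∂(Measure.pi fun i => betaDistribution m (γ i))

end

noncomputable section

namespace BetaPolytope

open scoped ENNReal RealInnerProductSpace

/-! Write d = m + 1. Almost surely no d of the points have affinely dependent projections along the
first axis and no further point lies on the hyperplane through d of them. The facets of P are then
exactly the simplices spanned by the d-element index sets I whose hyperplane H has all other points
on one side (`wieackerT_eq_sum`). The expectation thus becomes a finite sum over I, and each term
splits into "all others below H" and "all others above H".

For fixed I, the hyperplane is described as the graph of q + ⟪p, ·⟫, so that x_i = (q + ⟪p, t_i⟫,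
t_i). For given t the heights depend linearly on (q, p) with determinant `simplexDet t`, that is, m!
times a signed volume. This is the affine Blaschke–Petkantschin formula `lintegral_hyperplane`. With
c = `cosGraph p`, the hyperplane has signed distance h = q c from the origin, and a simplex in it
has volume `simplexVol t / c`.

The beta family is stable under sections: in orthonormal coordinates scaled by √(1 - h²), the
restriction of f_{d,β} to H is a multiple of f_{d-1,β} (`sliceMeasure_eq`). The volume moment
therefore separates from an explicit function of h. Integrating the slice masses shows that the
height of a beta point over any direction is a one-dimensional beta variable with parameter β + m/2,
so each remaining point lies below H with probability F(h) and above it with probability F(-h).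

What is left of the slope is c^(m+1) after the substitution h = q c, and its integral is half the
surface area of the sphere (`lintegral_cosGraph_pow`). The reflection h ↦ -h makes the two sides
contribute equally, which removes the half. For n = d the two one-sided events coincide instead of
being disjoint, and the single simplex would be counted twice; this is why n ≠ d. All integrals are
first computed as `lintegral`, and finiteness of the result gives integrability. -/

/-- Euclidean space of dimension `m`. -/
abbrev Euc (m : ℕ) := EuclideanSpace ℝ (Fin m)

/-! ### Splitting off the first coordinate. -/

/-- Prepending a coordinate identifies `ℝ × ℝ^m` with `ℝ^(m+1)`. -/
def consEquiv (m : ℕ) : (ℝ × Euc m) ≃ₗ[ℝ] Euc (m + 1) where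
  toFun p := WithLp.toLp 2 (Fin.cons p.1 p.2.ofLp)
  invFun x := (x 0, WithLp.toLp 2 fun i => x i.succ)
  map_add' p q := by ext i; cases i using Fin.cases <;> simp
  map_smul' c p := by ext i; cases i using Fin.cases <;> simp
  left_inv p := by ext <;> simp
  right_inv x := by ext i; cases i using Fin.cases <;> simp

variable {m : ℕ}

/-- The point of `ℝ^(m+1)` with first coordinate `r` and remaining coordinates `v`. -/
def consPt (r : ℝ) (v : Euc m) : Euc (m + 1) := consEquiv m (r, v)

/-- The coordinates of a point other than the first one. -/
def tailPt (x : Euc (m + 1)) : Euc m := ((consEquiv m).symm x).2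

@[simp] lemma consPt_zero (r : ℝ) (v : Euc m) : consPt r v 0 = r := rfl
@[simp] lemma consPt_succ (r : ℝ) (v : Euc m) (i : Fin m) : consPt r v i.succ = v i := rfl
@[simp] lemma tailPt_consPt (r : ℝ) (v : Euc m) : tailPt (consPt r v) = v := rfl
@[simp] lemma consPt_tailPt (x : Euc (m + 1)) : consPt (x 0) (tailPt x) = x :=
  (consEquiv m).right_inv x

lemma consPt_add (r s : ℝ) (v w : Euc m) : consPt (r + s) (v + w) = consPt r v + consPt s w :=
  map_add (consEquiv m) (r, v) (s, w)

lemma norm_sq_consPt (r : ℝ) (v : Euc m) : ‖consPt r v‖ ^ 2 = r ^ 2 + ‖v‖ ^ 2 := by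
  simp [EuclideanSpace.norm_sq_eq, Fin.sum_univ_succ]

@[fun_prop] lemma continuous_consPt : Continuous fun p : ℝ × Euc m => consPt p.1 p.2 :=
  (consEquiv m).toContinuousLinearEquiv.continuous

@[fun_prop] lemma measurable_consPt {α : Type*} [MeasurableSpace α] {f : α → ℝ} {g : α → Euc m}
    (hf : Measurable f) (hg : Measurable g) : Measurable fun a => consPt (f a) (g a) :=
  continuous_consPt.measurable.comp (hf.prodMk hg)

@[fun_prop] lemma continuous_tailPt : Continuous (tailPt (m := m)) :=
  continuous_snd.comp (consEquiv m).symm.toContinuousLinearEquiv.continuous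

lemma measurePreserving_consPt :
    MeasurePreserving (fun p : ℝ × Euc m => consPt p.1 p.2) volume volume := by
  have h1 : MeasurePreserving (fun p : ℝ × Euc m => (p.1, p.2.ofLp)) volume volume :=
    (MeasurePreserving.id volume).prod (PiLp.volume_preserving_ofLp (Fin m))
  have h2 := (volume_preserving_piFinSuccAbove (fun _ : Fin (m + 1) => ℝ) 0).symm
  have h3 := PiLp.volume_preserving_toLp (Fin (m + 1))
  have := h3.comp (h2.comp h1)
  convert! this using 1
  ext p i
  cases i using Fin.cases <;> rfl

lemma lintegral_consPt {f : Euc (m + 1) → ℝ≥0∞} (hf : Measurable f) :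
    ∫⁻ x, f x = ∫⁻ r : ℝ, ∫⁻ v : Euc m, f (consPt r v) := by
  rw [← measurePreserving_consPt.lintegral_comp hf, Measure.volume_eq_prod, lintegral_prod]
  exact (hf.comp measurePreserving_consPt.measurable).aemeasurable

lemma lintegral_consPt_symm {f : Euc (m + 1) → ℝ≥0∞} (hf : Measurable f) :
    ∫⁻ x, f x = ∫⁻ v : Euc m, ∫⁻ r : ℝ, f (consPt r v) := by
  rw [lintegral_consPt hf, lintegral_lintegral_swap]
  exact (hf.comp measurePreserving_consPt.measurable).aemeasurable

lemma lintegral_tuple_consPt {ι : Type*} [Fintype ι] {f : (ι → Euc (m + 1)) → ℝ≥0∞}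
    (hf : Measurable f) :
    ∫⁻ x, f x = ∫⁻ t : ι → Euc m, ∫⁻ r : ι → ℝ, f fun i => consPt (r i) (t i) := by
  have h1 : MeasurePreserving (fun (p : ι → ℝ × Euc m) i => consPt (p i).1 (p i).2)
      volume volume := volume_preserving_pi fun _ => measurePreserving_consPt
  have h2 := (volume_measurePreserving_arrowProdEquivProdArrow ℝ (Euc m) ι).symm
  have h3 := h1.comp h2
  have h4 : Measurable fun p : (ι → ℝ) × (ι → Euc m) => f fun i => consPt (p.1 i) (p.2 i) :=
    hf.comp h3.measurable
  rw [← h3.lintegral_comp hf, Measure.volume_eq_prod]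
  exact lintegral_prod_symm _ h4.aemeasurable

/-! ### Metric geometry of a hyperplane given as a graph. -/

/-- The cosine of the angle between the graph of `⟪p, ·⟫` and the horizontal hyperplane. -/
def cosGraph (p : Euc m) : ℝ := (√(1 + ‖p‖ ^ 2))⁻¹

lemma cosGraph_pos (p : Euc m) : 0 < cosGraph p := by unfold cosGraph; positivity

lemma cosGraph_sq (p : Euc m) : cosGraph p ^ 2 * (1 + ‖p‖ ^ 2) = 1 := by
  have : 0 < 1 + ‖p‖ ^ 2 := by positivity
  unfold cosGraph
  rw [inv_pow, Real.sq_sqrt this.le, inv_mul_cancel₀ this.ne']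

@[fun_prop] lemma continuous_cosGraph : Continuous (cosGraph (m := m)) := by
  unfold cosGraph
  refine Continuous.inv₀ (by fun_prop) fun p => ?_
  positivity

/-- The linear map from `ℝ^m` to itself whose lift to the graph of `⟪p, ·⟫` is isometric. -/
def graphMap (p : Euc m) : Euc m →ₗ[ℝ] Euc m :=
  -- The map must shrink the direction of p by the factor c = `cosGraph p` and fix its orthogonal
  -- complement. Since ‖p‖² = (1 - c²)/c², the coefficient (1 - c)/‖p‖² equals c²/(1 + c), a form
  -- that remains valid at p = 0.
  LinearMap.transvection (innerₛₗ ℝ p) (-(cosGraph p ^ 2 / (1 + cosGraph p)) • p)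

lemma graphMap_apply (p s : Euc m) :
    graphMap p s = s - (cosGraph p ^ 2 / (1 + cosGraph p) * ⟪p, s⟫) • p := by
  simp [graphMap, LinearMap.transvection.apply, smul_smul, sub_eq_add_neg, mul_comm]

lemma det_graphMap (p : Euc m) : LinearMap.det (graphMap p) = cosGraph p := by
  have h1 := cosGraph_pos p
  have h2 := cosGraph_sq p
  have : (graphMap p).det = 1 + _ := LinearMap.transvection.det _ _
  rw [this]
  simp only [innerₛₗ_apply_apply, inner_smul_right, real_inner_self_eq_norm_sq]
  field_simp
  linear_combination -h2

lemma inner_graphMap (p s : Euc m) : ⟪p, graphMap p s⟫ = cosGraph p * ⟪p, s⟫ := by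
  have h1 := cosGraph_pos p
  have h2 := cosGraph_sq p
  simp only [graphMap_apply, inner_sub_right, inner_smul_right, real_inner_self_eq_norm_sq]
  field_simp
  linear_combination -⟪p, s⟫ * h2

lemma norm_sq_graphMap (p s : Euc m) :
    ‖graphMap p s‖ ^ 2 + (cosGraph p * ⟪p, s⟫) ^ 2 = ‖s‖ ^ 2 := by
  have h1 := cosGraph_pos p
  have h2 := cosGraph_sq p
  rw [graphMap_apply, norm_sub_sq_real, inner_smul_right, norm_smul, mul_pow, Real.norm_eq_abs,
    sq_abs, real_inner_comm p s]
  field_simp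
  linear_combination (⟪p, s⟫ ^ 2 * cosGraph p ^ 2) * h2

/-- Orthogonal coordinates on the graph of `q + ⟪p, ·⟫`, projected to `ℝ^m`. -/
def graphParam (p : Euc m) (q : ℝ) (s : Euc m) : Euc m :=
  -- The parameter s = 0 gives the foot of the perpendicular from the origin, whose projection is -q
  -- c² p.
  graphMap p s - (q * cosGraph p ^ 2) • p

lemma inner_graphParam (p : Euc m) (q : ℝ) (s : Euc m) :
    q + ⟪p, graphParam p q s⟫ = q * cosGraph p ^ 2 + cosGraph p * ⟪p, s⟫ := by
  have h2 := cosGraph_sq p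
  rw [graphParam, inner_sub_right, inner_graphMap, inner_smul_right, real_inner_self_eq_norm_sq]
  linear_combination (-q) * h2

/-- Pythagoras: s is measured within the hyperplane from the foot of the perpendicular, which is at
distance |q c| from the origin. -/
lemma norm_sq_graphParam (p : Euc m) (q : ℝ) (s : Euc m) :
    ‖consPt (q + ⟪p, graphParam p q s⟫) (graphParam p q s)‖ ^ 2
      = ‖s‖ ^ 2 + (q * cosGraph p) ^ 2 := by
  have h2 := cosGraph_sq p
  have h3 := norm_sq_graphMap p s
  rw [norm_sq_consPt, inner_graphParam, graphParam, norm_sub_sq_real, inner_smul_right,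
    real_inner_comm p, inner_graphMap, norm_smul, mul_pow, Real.norm_eq_abs, sq_abs]
  linear_combination h3 + q ^ 2 * cosGraph p ^ 2 * h2

lemma isometry_graph (p : Euc m) (q : ℝ) :
    Isometry fun s => consPt (q + ⟪p, graphParam p q s⟫) (graphParam p q s) := by
  refine Isometry.of_dist_eq fun s s' => ?_
  have h : consPt (q + ⟪p, graphParam p q s⟫) (graphParam p q s)
      - consPt (q + ⟪p, graphParam p q s'⟫) (graphParam p q s')
      = consPt (cosGraph p * ⟪p, s - s'⟫) (graphMap p (s - s')) := by
    rw [sub_eq_iff_eq_add, ← consPt_add, inner_graphParam, inner_graphParam]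
    congr 1
    · rw [inner_sub_right]; ring
    · simp [graphParam]
  rw [dist_eq_norm, dist_eq_norm, h, ← sq_eq_sq₀ (norm_nonneg _) (norm_nonneg _), norm_sq_consPt,
    ← norm_sq_graphMap p (s - s')]
  ring


/-! ### The volume of a simplex as a determinant. -/

/-- The corner simplex `{x ≥ 0, ∑ x ≤ r}`. -/
def cornerSimplex (n : ℕ) (r : ℝ) : Set (Fin n → ℝ) := {x | (∀ i, 0 ≤ x i) ∧ ∑ i, x i ≤ r}

lemma measurableSet_cornerSimplex (n : ℕ) (r : ℝ) : MeasurableSet (cornerSimplex n r) := by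
  unfold cornerSimplex
  measurability

/-- Slicing at first coordinate x leaves a corner simplex of size r - x, so the induction integrates
(r - x)^n / n!. This is why the size r is kept general. -/
lemma volume_cornerSimplex (n : ℕ) {r : ℝ} (hr : 0 ≤ r) :
    volume (cornerSimplex n r) = ENNReal.ofReal (r ^ n / n.factorial) := by
  induction n generalizing r with
  | zero => simp [cornerSimplex, hr, volume_pi]
  | succ n ih =>
    rw [← ((volume_preserving_piFinSuccAbove (fun _ : Fin (n + 1) => ℝ) 0).symm).measure_preimage
      (measurableSet_cornerSimplex _ _).nullMeasurableSet, Measure.volume_eq_prod,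
      Measure.prod_apply ((MeasurableEquiv.measurable _) (measurableSet_cornerSimplex _ _))]
    have key : ∀ x : ℝ, volume (Prod.mk x ⁻¹'
        ((MeasurableEquiv.piFinSuccAbove (fun _ : Fin (n + 1) => ℝ) 0).symm ⁻¹'
          cornerSimplex (n + 1) r)) =
        (Set.Icc 0 r).indicator (fun x => ENNReal.ofReal ((r - x) ^ n / n.factorial)) x := by
      intro x
      have hset : (Prod.mk x ⁻¹'
        ((MeasurableEquiv.piFinSuccAbove (fun _ : Fin (n + 1) => ℝ) 0).symm ⁻¹'
          cornerSimplex (n + 1) r)) = {y | 0 ≤ x ∧ y ∈ cornerSimplex n (r - x)} := by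
        ext y
        simp [cornerSimplex, MeasurableEquiv.piFinSuccAbove, Fin.forall_fin_succ,
          Fin.sum_univ_succ, le_sub_iff_add_le', and_assoc]
      rw [hset]
      by_cases h : x ∈ Set.Icc 0 r
      · rw [Set.indicator_of_mem h, ← ih (sub_nonneg.2 h.2)]
        simp [h.1]
      · rw [Set.indicator_of_notMem h]
        convert! measure_empty (μ := volume)
        ext y
        simp only [cornerSimplex, Set.mem_ofPred_eq, Set.mem_empty_iff_false, iff_false, not_and]
        intro h0 h1 h2
        exact h ⟨h0, by linarith [Finset.sum_nonneg fun i (_ : i ∈ Finset.univ) => h1 i]⟩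
    simp_rw [key]
    rw [lintegral_indicator measurableSet_Icc, ← ofReal_integral_eq_lintegral_ofReal]
    · congr 1
      rw [integral_Icc_eq_integral_Ioc, ← intervalIntegral.integral_of_le hr,
        intervalIntegral.integral_div,
        intervalIntegral.integral_comp_sub_left (fun x => x ^ n) r, integral_pow,
        Nat.factorial_succ]
      push_cast
      simp
      field_simp
    · exact Continuous.integrableOn_Icc (by fun_prop)
    · refine (ae_restrict_iff' measurableSet_Icc).2 (.of_forall fun x hx => ?_)
      have := sub_nonneg.2 hx.2
      positivity

/-- The matrix with rows `(1, t i)`. -/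
def simplexMatrix (t : Fin (m + 1) → Euc m) : Matrix (Fin (m + 1)) (Fin (m + 1)) ℝ :=
  Matrix.of fun i => Fin.cons 1 (t i).ofLp

/-- `m!` times the signed volume of the simplex with vertices `t i`. -/
def simplexDet (t : Fin (m + 1) → Euc m) : ℝ := (simplexMatrix t).det

/-- Subtracting the first row from the others clears the column of ones below its first entry;
expansion along that column remains. -/
lemma simplexDet_eq (t : Fin (m + 1) → Euc m) :
    simplexDet t = (Matrix.of fun i j : Fin m => t i.succ j - t 0 j).det := by
  let B : Matrix (Fin (m + 1)) (Fin (m + 1)) ℝ :=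
    Matrix.of fun i => if i = 0 then simplexMatrix t 0 else simplexMatrix t i - simplexMatrix t 0
  have h : simplexDet t = B.det := by
    refine Matrix.det_eq_of_forall_row_eq_smul_add_const (fun i => if i = 0 then 0 else 1) 0
      (by simp) fun i j => ?_
    by_cases hi : i = 0 <;> simp [B, hi]
  rw [h, Matrix.det_succ_column_zero, Finset.sum_eq_single 0]
  · simp only [Fin.val_zero, pow_zero, one_mul, Fin.succAbove_zero]
    have : B 0 0 = 1 := by simp [B, simplexMatrix]
    rw [this, one_mul]
    rfl
  · intro i _ hi
    simp [B, hi, simplexMatrix]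
  · simp

/-- Barycentric coordinates with the weight of `t 0` eliminated: it is 1 minus the sum of the
others, and its nonnegativity is the inequality of the corner simplex. -/
lemma convexHull_range_eq_image (t : Fin (m + 1) → Euc m) :
    convexHull ℝ (Set.range t) =
      (fun x : Fin m → ℝ => t 0 + ∑ i, x i • (t i.succ - t 0)) '' cornerSimplex m 1 := by
  apply subset_antisymm
  · apply convexHull_min
    · rintro _ ⟨i, rfl⟩
      refine Fin.cases ?_ (fun i => ?_) i
      · exact ⟨0, by simp [cornerSimplex]⟩
      · refine ⟨Pi.single i 1, ⟨fun j => ?_, ?_⟩, ?_⟩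
        · by_cases h : j = i
          · subst h; simp
          · simp [h]
        · simp
        · simp [Pi.single_apply]
    · have hc : Convex ℝ (cornerSimplex m 1) := by
        intro x hx y hy a b ha hb hab
        refine ⟨fun i => ?_, ?_⟩
        · have := hx.1 i; have := hy.1 i
          simp only [Pi.add_apply, Pi.smul_apply, smul_eq_mul]; positivity
        · simp only [Pi.add_apply, Pi.smul_apply, smul_eq_mul, Finset.sum_add_distrib,
            ← Finset.mul_sum]
          nlinarith [hx.2, hy.2]
      rintro _ ⟨x, hx, rfl⟩ _ ⟨y, hy, rfl⟩ a b ha hb hab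
      refine ⟨a • x + b • y, hc hx hy ha hb hab, ?_⟩
      simp only [Pi.add_apply, Pi.smul_apply, smul_eq_mul, add_smul, Finset.sum_add_distrib,
        smul_add, Finset.smul_sum, mul_smul]
      have : t 0 = a • t 0 + b • t 0 := by rw [← add_smul, hab, one_smul]
      nth_rewrite 1 [this]
      abel
  · rintro _ ⟨x, hx, rfl⟩
    have h0 : t 0 + ∑ i, x i • (t i.succ - t 0) =
        ∑ i : Fin (m + 1), (Fin.cons (1 - ∑ i, x i) x : Fin (m + 1) → ℝ) i • t i := by
      simp only [smul_sub, Finset.sum_sub_distrib, Fin.sum_univ_succ, Fin.cons_zero, Fin.cons_succ,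
        sub_smul, one_smul, Finset.sum_smul]
      abel
    simp only [h0]
    refine (convex_convexHull ℝ _).sum_mem (fun i _ => ?_) ?_
      fun i _ => subset_convexHull ℝ _ ⟨i, rfl⟩
    · refine Fin.cases ?_ (fun i => ?_) i
      · simpa using hx.2
      · simpa using hx.1 i
    · simp [Fin.sum_univ_succ]

/-- The volume of the simplex spanned by `m + 1` points of `ℝ^m`. -/
def simplexVol (t : Fin (m + 1) → Euc m) : ℝ :=
  (volume : Measure (Euc m)).real (convexHull ℝ (Set.range t))

/-- The simplex is an affine image of the corner simplex, which has volume 1/m!. Besides giving the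
Jacobian a geometric meaning, this makes `simplexVol` measurable. -/
theorem simplexVol_eq (t : Fin (m + 1) → Euc m) :
    simplexVol t = |simplexDet t| / m.factorial := by
  have h1 : convexHull ℝ (Set.range t) = (fun y => t 0 + y) ''
      (WithLp.toLp 2 '' (Matrix.toLin' (Matrix.of fun i j : Fin m => t i.succ j - t 0 j).transpose ''
        cornerSimplex m 1)) := by
    rw [convexHull_range_eq_image, Set.image_image, Set.image_image]
    congr 1
    funext x
    congr 1
    ext j
    simp [Matrix.mulVec, dotProduct, mul_comm]
  rw [simplexVol, Measure.real, h1, Set.image_add_left, measure_preimage_add]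
  have h2 : ∀ S : Set (Fin m → ℝ), volume (WithLp.toLp 2 '' S : Set (Euc m)) = volume S := by
    intro S
    have := (EuclideanSpace.volume_preserving_symm_measurableEquiv_toLp (Fin m)).measure_preimage_equiv S
    rw [← this]
    congr 1
    ext x
    constructor
    · rintro ⟨y, hy, rfl⟩; exact hy
    · intro hx; exact ⟨_, hx, rfl⟩
  rw [h2, Measure.addHaar_image_linearMap, volume_cornerSimplex m zero_le_one, LinearMap.det_toLin',
    Matrix.det_transpose, ← simplexDet_eq, ← ENNReal.ofReal_mul (abs_nonneg _),
    ENNReal.toReal_ofReal (by positivity)]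
  simp [div_eq_mul_inv]

lemma simplexVol_nonneg (t : Fin (m + 1) → Euc m) : 0 ≤ simplexVol t := measureReal_nonneg

lemma simplexVol_image (A : Euc m →ₗ[ℝ] Euc m) (c : Euc m) (t : Fin (m + 1) → Euc m) :
    simplexVol (fun i => A (t i) + c) = |LinearMap.det A| * simplexVol t := by
  have h1 : Set.range (fun i => A (t i) + c) =
      (A.toAffineMap + AffineMap.const ℝ (Euc m) c) '' Set.range t := by
    ext; simp
  rw [simplexVol, h1, ← AffineMap.image_convexHull]
  have h2 : ⇑(A.toAffineMap + AffineMap.const ℝ (Euc m) c) = (fun y => y + c) ∘ A := by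
    ext; simp
  rw [h2, Set.image_comp, Set.image_add_right, Measure.real, measure_preimage_add_right,
    Measure.addHaar_image_linearMap, ENNReal.toReal_mul, ENNReal.toReal_ofReal (abs_nonneg _)]
  rfl

@[fun_prop] lemma continuous_simplexMatrix : Continuous (simplexMatrix (m := m)) := by
  refine continuous_matrix fun i j => ?_
  refine Fin.cases ?_ (fun j => ?_) j <;> simp only [simplexMatrix, Matrix.of_apply, Fin.cons_zero,
    Fin.cons_succ] <;> fun_prop

@[fun_prop] lemma continuous_simplexDet : Continuous (simplexDet (m := m)) :=
  continuous_simplexMatrix.matrix_det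

@[fun_prop] lemma measurable_simplexVol : Measurable (simplexVol (m := m)) := by
  have : simplexVol (m := m) = fun t => |simplexDet t| / m.factorial := funext simplexVol_eq
  rw [this]
  have := continuous_simplexDet (m := m)
  fun_prop


/-! ### Products of densities. -/

lemma lintegral_fin_prod {n : ℕ} {α : Fin n → Type*} [∀ i, MeasurableSpace (α i)]
    (μ : ∀ i, Measure (α i)) [∀ i, SigmaFinite (μ i)] (f : ∀ i, α i → ℝ≥0∞)
    (hf : ∀ i, Measurable (f i)) :
    ∫⁻ x, ∏ i, f i (x i) ∂(Measure.pi μ) = ∏ i, ∫⁻ x, f i x ∂(μ i) := by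
  induction n with
  | zero => simp
  | succ n ih =>
    have h := lintegral_prod_mul (μ := μ 0) (ν := Measure.pi fun j : Fin n => μ j.succ)
      (f := f 0) (g := fun y => ∏ i, f (Fin.succ i) (y i)) (hf 0).aemeasurable
      (Finset.measurable_fun_prod _ fun i _ => (hf _).comp (measurable_pi_apply i)).aemeasurable
    rw [← (measurePreserving_piFinSuccAbove μ 0).symm.lintegral_comp (by fun_prop),
      Fin.prod_univ_succ, ← ih _ _ fun i => hf _, ← h]
    simp_rw [Fin.prod_univ_succ]
    rfl

lemma lintegral_fintype_prod {ι : Type*} [Fintype ι] {α : ι → Type*} [∀ i, MeasurableSpace (α i)]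
    (μ : ∀ i, Measure (α i)) [∀ i, SigmaFinite (μ i)] (f : ∀ i, α i → ℝ≥0∞)
    (hf : ∀ i, Measurable (f i)) :
    ∫⁻ x, ∏ i, f i (x i) ∂(Measure.pi μ) = ∏ i, ∫⁻ x, f i x ∂(μ i) := by
  let e := (Fintype.equivFin ι).symm
  rw [← (measurePreserving_piCongrLeft _ e).lintegral_comp (by fun_prop)]
  simp_rw [← e.prod_comp, MeasurableEquiv.coe_piCongrLeft, Equiv.piCongrLeft_apply_apply]
  exact lintegral_fin_prod _ _ fun i => hf _

lemma pi_withDensity {ι : Type*} [Fintype ι] {α : ι → Type*} [∀ i, MeasurableSpace (α i)]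
    (μ : ∀ i, Measure (α i)) [∀ i, SigmaFinite (μ i)] (f : ∀ i, α i → ℝ≥0∞)
    (hf : ∀ i, Measurable (f i)) [∀ i, SigmaFinite ((μ i).withDensity (f i))] :
    Measure.pi (fun i => (μ i).withDensity (f i))
      = (Measure.pi μ).withDensity fun x => ∏ i, f i (x i) := by
  refine Measure.pi_eq fun s hs => ?_
  rw [withDensity_apply _ (.univ_pi hs), Measure.restrict_pi_pi, lintegral_fintype_prod _ _ hf]
  exact Finset.prod_congr rfl fun i _ => (withDensity_apply _ (hs i)).symm

/-! ### The affine Blaschke–Petkantschin formula in graph coordinates. -/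

/-- Along the line t + s w, with w the vertices 0, e_1, ..., e_m, the determinant is a
characteristic polynomial in s. It is monic, so it has finitely many zeros; Fubini gives one s that
works for almost every t, and translation invariance removes the shift. -/
lemma ae_simplexDet_ne_zero : ∀ᵐ t : Fin (m + 1) → Euc m, simplexDet t ≠ 0 := by
  let w : Fin (m + 1) → Euc m := Fin.cons 0 fun i => EuclideanSpace.single i 1
  have hw : ∀ (t : Fin (m + 1) → Euc m) (s : ℝ), simplexDet (t + s • w) =
      (-Matrix.of fun i j : Fin m => t i.succ j - t 0 j).charpoly.eval s := by
    intro t s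
    rw [simplexDet_eq, Matrix.eval_charpoly]
    congr 1
    ext i j
    simp [w, eq_comm (a := i), Matrix.scalar_apply, Matrix.diagonal_apply]
    ring
  have hcont : Continuous fun z : (Fin (m + 1) → Euc m) × ℝ => simplexDet (z.1 + z.2 • w) :=
    continuous_simplexDet.comp (by fun_prop)
  have h1 : ∀ᵐ t : Fin (m + 1) → Euc m, ∀ᵐ s : ℝ, simplexDet (t + s • w) ≠ 0 := by
    refine .of_forall fun t => ?_
    have hfin : {s : ℝ | simplexDet (t + s • w) = 0}.Finite := by
      simp_rw [hw]
      refine (Polynomial.finite_setOfPred_isRoot (Matrix.charpoly_monic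
        (-Matrix.of fun i j : Fin m => t i.succ j - t 0 j)).ne_zero)
    exact compl_mem_ae_iff.2 (hfin.measure_zero _)
  have h2 := (Measure.ae_ae_comm (hcont.measurable (measurableSet_singleton 0)).compl).1 h1
  obtain ⟨s, hs⟩ := h2.exists
  have h3 := (measurePreserving_sub_right volume (s • w)).quasiMeasurePreserving.ae hs
  filter_upwards [h3] with t ht
  simpa using ht

lemma simplexMatrix_mulVec (t : Fin (m + 1) → Euc m) (q : ℝ) (p : Euc m) :
    Matrix.mulVec (simplexMatrix t) (consPt q p).ofLp = fun i => q + ⟪p, t i⟫ := by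
  ext i
  simp [Matrix.mulVec, dotProduct, Fin.sum_univ_succ, simplexMatrix, PiLp.inner_apply]

/-- For fixed projections t, intercept and slope are linear coordinates on the space of height
vectors, with matrix `simplexMatrix t`. -/
lemma lintegral_height {t : Fin (m + 1) → Euc m} (ht : simplexDet t ≠ 0)
    {f : (Fin (m + 1) → ℝ) → ℝ≥0∞} (hf : Measurable f) :
    ∫⁻ r, f r = ∫⁻ p : Euc m, ∫⁻ q : ℝ,
      ENNReal.ofReal |simplexDet t| * f fun i => q + ⟪p, t i⟫ := by
  have h1 := Real.map_matrix_volume_pi_eq_smul_volume_pi ht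
  have hlin : Measurable (Matrix.toLin' (simplexMatrix t)) :=
    (LinearMap.continuous_of_finiteDimensional _).measurable
  have h2 : ∫⁻ c, f (Matrix.mulVec (simplexMatrix t) c)
      = ENNReal.ofReal |(simplexDet t)⁻¹| * ∫⁻ r, f r := by
    have := lintegral_map (μ := volume) hf hlin
    rw [h1, lintegral_smul_measure] at this
    exact this.symm
  have hmul : Measurable fun c => f (Matrix.mulVec (simplexMatrix t) c) := hf.comp hlin
  have h3 : ∫⁻ c, f (Matrix.mulVec (simplexMatrix t) c)
      = ∫⁻ p : Euc m, ∫⁻ q : ℝ, f fun i => q + ⟪p, t i⟫ := by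
    rw [← (PiLp.volume_preserving_ofLp (Fin (m + 1))).lintegral_comp hmul]
    refine (lintegral_consPt_symm
      (f := fun x => f (Matrix.mulVec (simplexMatrix t) x.ofLp))
      (hmul.comp (PiLp.volume_preserving_ofLp (Fin (m + 1))).measurable)).trans ?_
    simp_rw [simplexMatrix_mulVec]
  have hne : ENNReal.ofReal |simplexDet t| ≠ ∞ := ENNReal.ofReal_ne_top
  simp_rw [lintegral_const_mul' _ _ hne]
  rw [← h3, h2, ← mul_assoc, ← ENNReal.ofReal_mul (abs_nonneg _), ← abs_mul,
    mul_inv_cancel₀ ht]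
  simp

/-- The affine Blaschke–Petkantschin formula for hyperplanes, in graph coordinates. -/
theorem lintegral_hyperplane {f : (Fin (m + 1) → Euc (m + 1)) → ℝ≥0∞} (hf : Measurable f) :
    ∫⁻ x, f x = ∫⁻ p : Euc m, ∫⁻ q : ℝ, ∫⁻ t : Fin (m + 1) → Euc m,
      ENNReal.ofReal |simplexDet t| * f fun i => consPt (q + ⟪p, t i⟫) (t i) := by
  have hmeas : Measurable fun z : ((Fin (m + 1) → Euc m) × Euc m) × ℝ =>
      ENNReal.ofReal |simplexDet z.1.1| *
        f fun i => consPt (z.2 + ⟪z.1.2, z.1.1 i⟫) (z.1.1 i) := by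
    have := continuous_simplexDet (m := m)
    refine Measurable.mul (by fun_prop) (hf.comp (measurable_pi_lambda _ fun i => ?_))
    refine measurable_consPt ?_ ?_ <;> fun_prop
  rw [lintegral_tuple_consPt hf]
  calc _ = ∫⁻ t : Fin (m + 1) → Euc m, ∫⁻ p : Euc m, ∫⁻ q : ℝ,
      ENNReal.ofReal |simplexDet t| * f fun i => consPt (q + ⟪p, t i⟫) (t i) := by
        refine lintegral_congr_ae ?_
        filter_upwards [ae_simplexDet_ne_zero] with t ht
        refine lintegral_height ht (hf.comp (measurable_pi_lambda _ fun i => ?_))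
        exact measurable_consPt (measurable_pi_apply i) measurable_const
    _ = ∫⁻ p : Euc m, ∫⁻ t : Fin (m + 1) → Euc m, ∫⁻ q : ℝ,
      ENNReal.ofReal |simplexDet t| * f fun i => consPt (q + ⟪p, t i⟫) (t i) :=
        lintegral_lintegral_swap hmeas.lintegral_prod_right'.aemeasurable
    _ = _ := by
        refine lintegral_congr fun p => lintegral_lintegral_swap ?_
        exact (hmeas.comp (f := fun z : (Fin (m + 1) → Euc m) × ℝ => ((z.1, p), z.2))
          (by fun_prop)).aemeasurable

/-- The hyperplane through the points `x i`, as the graph of `intercept + ⟪slope, ·⟫`: the first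
coordinate is the intercept, the remaining ones are the slope. -/
def graphCoef (x : Fin (m + 1) → Euc (m + 1)) : Euc (m + 1) :=
  WithLp.toLp 2 (Matrix.mulVec (simplexMatrix fun i => tailPt (x i))⁻¹ fun i => x i 0)

lemma graphCoef_consPt {t : Fin (m + 1) → Euc m} (ht : simplexDet t ≠ 0) (q : ℝ) (p : Euc m) :
    graphCoef (fun i => consPt (q + ⟪p, t i⟫) (t i)) = consPt q p := by
  have h : IsUnit (simplexMatrix t).det := isUnit_iff_ne_zero.2 ht
  simp only [graphCoef, tailPt_consPt, consPt_zero]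
  rw [← simplexMatrix_mulVec, Matrix.mulVec_mulVec, Matrix.nonsing_inv_mul _ h, Matrix.one_mulVec]

lemma height_eq_graphCoef {x : Fin (m + 1) → Euc (m + 1)}
    (hx : simplexDet (fun i => tailPt (x i)) ≠ 0) (i : Fin (m + 1)) :
    x i 0 = graphCoef x 0 + ⟪tailPt (graphCoef x), tailPt (x i)⟫ := by
  have h : IsUnit (simplexMatrix fun i => tailPt (x i)).det := isUnit_iff_ne_zero.2 hx
  have := simplexMatrix_mulVec (fun i => tailPt (x i)) (graphCoef x 0) (tailPt (graphCoef x))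
  rw [consPt_tailPt, graphCoef, Matrix.mulVec_mulVec, Matrix.mul_nonsing_inv _ h,
    Matrix.one_mulVec] at this
  exact congrFun this i

@[fun_prop] lemma measurable_graphCoef : Measurable (graphCoef (m := m)) := by
  have h1 : Continuous fun x : Fin (m + 1) → Euc (m + 1) => simplexMatrix fun i => tailPt (x i) := by
    fun_prop
  have h2 : Measurable fun x : Fin (m + 1) → Euc (m + 1) =>
      ((simplexMatrix fun i => tailPt (x i)).det)⁻¹ := h1.matrix_det.measurable.inv
  have h3 : Continuous fun x : Fin (m + 1) → Euc (m + 1) =>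
      Matrix.mulVec (simplexMatrix fun i => tailPt (x i)).adjugate fun i => x i 0 :=
    h1.matrix_adjugate.matrix_mulVec (by fun_prop)
  -- Cramer's rule exhibits `graphCoef` as the inverse of a determinant times a polynomial map,
  -- hence measurable also across degenerate configurations.
  have h4 : graphCoef (m := m) = fun x => WithLp.toLp 2
      (((simplexMatrix fun i => tailPt (x i)).det)⁻¹ •
        Matrix.mulVec (simplexMatrix fun i => tailPt (x i)).adjugate fun i => x i 0) := by
    funext x
    rw [graphCoef, Matrix.inv_def, Matrix.smul_mulVec, Ring.inverse_eq_inv']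
  rw [h4]
  exact (WithLp.measurable_toLp _ _).comp (h2.smul h3.measurable)


/-! ### Hyperplane sections of beta densities. -/

lemma lintegral_linearMap_add {A : Euc m →ₗ[ℝ] Euc m} (hA : LinearMap.det A ≠ 0) (c : Euc m)
    {f : Euc m → ℝ≥0∞} (hf : Measurable f) :
    ∫⁻ t, f t = ENNReal.ofReal |LinearMap.det A| * ∫⁻ y, f (A y + c) := by
  have hlin : Measurable A := (LinearMap.continuous_of_finiteDimensional A).measurable
  have h1 := lintegral_map (μ := volume) (hf.comp (measurable_add_const c)) hlin
  rw [Measure.map_linearMap_addHaar_eq_smul_addHaar _ hA, lintegral_smul_measure] at h1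
  simp only [Function.comp_apply, lintegral_add_right_eq_self f c, smul_eq_mul] at h1
  rw [← h1, ← mul_assoc, ← ENNReal.ofReal_mul (abs_nonneg _), ← abs_mul, mul_inv_cancel₀ hA]
  simp

lemma lintegral_mul_add {a : ℝ} (ha : a ≠ 0) (c : ℝ) {f : ℝ → ℝ≥0∞} (hf : Measurable f) :
    ∫⁻ t, f t = ENNReal.ofReal |a| * ∫⁻ y, f (a * y + c) := by
  have h1 := lintegral_map (μ := volume) (hf.comp (measurable_add_const c))
    (measurable_const_mul a)
  rw [Real.map_volume_mul_left ha, lintegral_smul_measure] at h1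
  simp only [Function.comp_apply, lintegral_add_right_eq_self f c, smul_eq_mul] at h1
  rw [← h1, ← mul_assoc, ← ENNReal.ofReal_mul (abs_nonneg _), ← abs_mul, mul_inv_cancel₀ ha]
  simp

lemma betaConst_pos (d : ℕ) {β : ℝ} (hβ : -1 < β) : 0 < betaConst d β := by
  have h1 : 0 < β + 1 := by linarith
  have h2 : 0 < (d : ℝ) / 2 + β + 1 := by
    have : (0 : ℝ) ≤ d := d.cast_nonneg
    linarith
  have := Real.Gamma_pos_of_pos h1
  have := Real.Gamma_pos_of_pos h2
  unfold betaConst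
  positivity

@[fun_prop] lemma measurable_betaDensity (d : ℕ) (β : ℝ) : Measurable (betaDensity d β) := by
  unfold betaDensity
  exact Measurable.ite (measurableSet_le measurable_norm measurable_const) (by fun_prop)
    measurable_const

/-- The beta density restricted to the graph of `q + ⟪p, ·⟫`, as a measure on `ℝ^m`. -/
def sliceMeasure (p : Euc m) (q β : ℝ) : Measure (Euc m) :=
  volume.withDensity fun t => ENNReal.ofReal (betaDensity (m + 1) β (consPt (q + ⟪p, t⟫) t))

/-- Scaled orthogonal coordinates, mapping the unit ball onto the section of the unit ball. -/
def sliceParam (p : Euc m) (q : ℝ) (y : Euc m) : Euc m :=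
  graphParam p q (√(1 - (q * cosGraph p) ^ 2) • y)

/-- The total mass of `sliceMeasure`. -/
def sliceMass (p : Euc m) (q β : ℝ) : ℝ :=
  cosGraph p * (betaConst (m + 1) β / betaConst m β) *
    (1 - (q * cosGraph p) ^ 2) ^ (β + (m : ℝ) / 2)

lemma sliceParam_eq (p : Euc m) (q : ℝ) (y : Euc m) :
    sliceParam p q y =
      (√(1 - (q * cosGraph p) ^ 2) • graphMap p) y + -((q * cosGraph p ^ 2) • p) := by
  simp [sliceParam, graphParam, sub_eq_add_neg]

lemma det_sliceParam (p : Euc m) (q : ℝ) :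
    LinearMap.det (√(1 - (q * cosGraph p) ^ 2) • graphMap p)
      = √(1 - (q * cosGraph p) ^ 2) ^ m * cosGraph p := by
  rw [LinearMap.det_smul, det_graphMap]; simp

lemma measurable_sliceParam (p : Euc m) (q : ℝ) : Measurable (sliceParam p q) := by
  have h : Continuous (graphMap p) := LinearMap.continuous_of_finiteDimensional _
  unfold sliceParam graphParam
  fun_prop

/-- On the section, 1 - ‖x‖² factors as (1 - h²)(1 - ‖y‖²) with h = q c, so the power factors as
well and the supports correspond. -/
lemma betaDensity_slice {β : ℝ} (hβ : -1 < β) (p : Euc m) (q : ℝ) (hq : |q * cosGraph p| < 1)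
    (y : Euc m) :
    betaDensity (m + 1) β (consPt (q + ⟪p, sliceParam p q y⟫) (sliceParam p q y)) =
      betaConst (m + 1) β / betaConst m β * (1 - (q * cosGraph p) ^ 2) ^ β
        * betaDensity m β y := by
  have hpos : 0 < 1 - (q * cosGraph p) ^ 2 := by
    have := (sq_lt_one_iff_abs_lt_one (q * cosGraph p)).2 hq; linarith
  have hn : 1 - ‖consPt (q + ⟪p, sliceParam p q y⟫) (sliceParam p q y)‖ ^ 2
      = (1 - (q * cosGraph p) ^ 2) * (1 - ‖y‖ ^ 2) := by
    rw [sliceParam, norm_sq_graphParam, norm_smul, mul_pow, Real.norm_eq_abs, sq_abs,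
      Real.sq_sqrt hpos.le]
    ring
  have hle : ‖consPt (q + ⟪p, sliceParam p q y⟫) (sliceParam p q y)‖ ≤ 1 ↔ ‖y‖ ≤ 1 := by
    rw [← sq_le_one_iff₀ (norm_nonneg _), ← sq_le_one_iff₀ (norm_nonneg y), ← sub_nonneg, hn,
      mul_nonneg_iff_of_pos_left hpos, sub_nonneg]
  have hc := (betaConst_pos m hβ).ne'
  simp only [betaDensity, hle]
  split_ifs with h
  · have : 0 ≤ 1 - ‖y‖ ^ 2 := by nlinarith [norm_nonneg y]
    rw [hn, Real.mul_rpow hpos.le this]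
    field_simp
  · simp

instance (d : ℕ) (β : ℝ) : SigmaFinite (betaDistribution d β) := by
  unfold betaDistribution
  exact SigmaFinite.withDensity_ofReal _

lemma lintegral_betaDistribution {d : ℕ} {β : ℝ} {f : Euc d → ℝ≥0∞} (hf : Measurable f) :
    ∫⁻ x, f x ∂(betaDistribution d β) = ∫⁻ x, ENNReal.ofReal (betaDensity d β x) * f x := by
  rw [betaDistribution, lintegral_withDensity_eq_lintegral_mul _ (by fun_prop) hf]; rfl

/-- Sections of beta distributions are again beta with the same parameter. The mass collects the
density factor (1 - h²)^β and the Jacobian (1 - h²)^(m/2) c of `sliceParam`. -/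
theorem sliceMeasure_eq {β : ℝ} (hβ : -1 < β) (p : Euc m) (q : ℝ) (hq : |q * cosGraph p| < 1) :
    sliceMeasure p q β =
      ENNReal.ofReal (sliceMass p q β) • (betaDistribution m β).map (sliceParam p q) := by
  have hpos : 0 < 1 - (q * cosGraph p) ^ 2 := by
    have := (sq_lt_one_iff_abs_lt_one (q * cosGraph p)).2 hq; linarith
  have hs := cosGraph_pos p
  have hdet : 0 < LinearMap.det (√(1 - (q * cosGraph p) ^ 2) • graphMap p) := by
    rw [det_sliceParam]; positivity
  have hc1 := betaConst_pos m hβ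
  have hc2 := betaConst_pos (m + 1) hβ
  have hdens : Measurable fun t : Euc m =>
      ENNReal.ofReal (betaDensity (m + 1) β (consPt (q + ⟪p, t⟫) t)) :=
    ((measurable_betaDensity _ _).comp (measurable_consPt (by fun_prop) (by fun_prop))).ennreal_ofReal
  refine Measure.ext_of_lintegral _ fun f hf => ?_
  rw [sliceMeasure, lintegral_withDensity_eq_lintegral_mul _ hdens hf, lintegral_smul_measure,
    lintegral_map hf (measurable_sliceParam p q),
    lintegral_betaDistribution (f := fun y => f (sliceParam p q y))
      (hf.comp (measurable_sliceParam p q)),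
    lintegral_linearMap_add hdet.ne' (-((q * cosGraph p ^ 2) • p)) (hdens.mul hf)]
  simp_rw [← sliceParam_eq, Pi.mul_apply, betaDensity_slice hβ p q hq]
  have h0 : 0 ≤ betaConst (m + 1) β / betaConst m β * (1 - (q * cosGraph p) ^ 2) ^ β := by
    positivity
  simp_rw [ENNReal.ofReal_mul h0, mul_assoc]
  rw [lintegral_const_mul' _ _ ENNReal.ofReal_ne_top, ← mul_assoc,
    ← ENNReal.ofReal_mul (abs_nonneg _), smul_eq_mul]
  congr 2
  rw [abs_of_pos hdet, det_sliceParam, sliceMass, Real.rpow_add hpos, Real.sqrt_eq_rpow,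
    ← Real.rpow_natCast, ← Real.rpow_mul hpos.le]
  ring_nf

/-- Cauchy–Schwarz: q is the inner product of (1, -p) with the point, and (1, -p) has norm 1/c. -/
lemma abs_mul_cosGraph_le_norm (p : Euc m) (q : ℝ) (t : Euc m) :
    |q * cosGraph p| ≤ ‖consPt (q + ⟪p, t⟫) t‖ := by
  have hs := cosGraph_pos p
  have h2 := cosGraph_sq p
  rw [← abs_of_nonneg (norm_nonneg (consPt _ _)), ← sq_le_sq, norm_sq_consPt]
  have h3 := abs_real_inner_le_norm p t
  have h4 : ⟪p, t⟫ ^ 2 ≤ ‖p‖ ^ 2 * ‖t‖ ^ 2 := by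
    rw [← mul_pow, ← sq_abs ⟪p, t⟫]; gcongr
  have h5 : q ^ 2 ≤ (1 + ‖p‖ ^ 2) * ((q + ⟪p, t⟫) ^ 2 + ‖t‖ ^ 2) := by
    by_cases hp : ‖p‖ = 0
    · have : p = 0 := norm_eq_zero.1 hp
      subst this
      simp
    · have hp' : 0 < ‖p‖ ^ 2 := by positivity
      have h6 : 0 ≤ (‖p‖ ^ 2 * (q + ⟪p, t⟫) + ⟪p, t⟫) ^ 2 / ‖p‖ ^ 2 := by positivity
      have h7 : 0 ≤ (1 + ‖p‖ ^ 2) * (‖p‖ ^ 2 * ‖t‖ ^ 2 - ⟪p, t⟫ ^ 2) / ‖p‖ ^ 2 := by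
        have := sub_nonneg.2 h4
        positivity
      -- The deficit is written as a square plus the Cauchy–Schwarz gap of p and t. The division by
      -- ‖p‖² is the reason for treating p = 0 apart.
      have h8 : (1 + ‖p‖ ^ 2) * ((q + ⟪p, t⟫) ^ 2 + ‖t‖ ^ 2) - q ^ 2
        = (‖p‖ ^ 2 * (q + ⟪p, t⟫) + ⟪p, t⟫) ^ 2 / ‖p‖ ^ 2
          + (1 + ‖p‖ ^ 2) * (‖p‖ ^ 2 * ‖t‖ ^ 2 - ⟪p, t⟫ ^ 2) / ‖p‖ ^ 2 := by
        field_simp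
        ring
      linarith
  calc (q * cosGraph p) ^ 2 = cosGraph p ^ 2 * q ^ 2 := by ring
    _ ≤ cosGraph p ^ 2 * ((1 + ‖p‖ ^ 2) * ((q + ⟪p, t⟫) ^ 2 + ‖t‖ ^ 2)) := by gcongr
    _ = _ := by linear_combination ((q + ⟪p, t⟫) ^ 2 + ‖t‖ ^ 2) * h2

lemma sliceMeasure_eq_zero {β : ℝ} (p : Euc m) (q : ℝ) (hq : 1 < |q * cosGraph p|) :
    sliceMeasure p q β = 0 := by
  have : (fun t => ENNReal.ofReal (betaDensity (m + 1) β (consPt (q + ⟪p, t⟫) t)))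
      = fun _ : Euc m => 0 := by
    funext t
    have h := hq.trans_le (abs_mul_cosGraph_le_norm p q t)
    simp [betaDensity, not_le.2 h]
  rw [sliceMeasure, this]
  exact withDensity_zero

/-- The beta distribution disintegrated along a family of parallel hyperplanes. -/
theorem lintegral_height_sub {β : ℝ} (p : Euc m) {g : ℝ → ℝ≥0∞}
    (hg : Measurable g) :
    ∫⁻ z, g (z 0 - ⟪p, tailPt z⟫) ∂(betaDistribution (m + 1) β)
      = ∫⁻ q, g q * sliceMeasure p q β Set.univ := by
  have hg' : Measurable fun z : Euc (m + 1) => g (z 0 - ⟪p, tailPt z⟫) := by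
    refine hg.comp ?_
    have := continuous_tailPt (m := m)
    fun_prop
  have hF : Measurable fun z : Euc (m + 1) =>
      ENNReal.ofReal (betaDensity (m + 1) β z) * g (z 0 - ⟪p, tailPt z⟫) :=
    (by fun_prop : Measurable fun z : Euc (m + 1) => ENNReal.ofReal (betaDensity (m + 1) β z)).mul hg'
  rw [lintegral_betaDistribution hg', lintegral_consPt_symm hF]
  have hjoint : Measurable fun z : Euc m × ℝ =>
      ENNReal.ofReal (betaDensity (m + 1) β (consPt (z.2 + ⟪p, z.1⟫) z.1)) * g z.2 := by
    refine Measurable.mul ?_ (hg.comp measurable_snd)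
    exact ((measurable_betaDensity _ _).comp
      (measurable_consPt (by fun_prop) (by fun_prop))).ennreal_ofReal
  have h1 : ∀ v : Euc m, ∫⁻ r : ℝ, ENNReal.ofReal (betaDensity (m + 1) β (consPt r v)) *
      g (consPt r v 0 - ⟪p, tailPt (consPt r v)⟫) = ∫⁻ q : ℝ,
      ENNReal.ofReal (betaDensity (m + 1) β (consPt (q + ⟪p, v⟫) v)) * g q := by
    intro v
    -- Over each v the height is translated by ⟪p, v⟫: a shear of Jacobian 1 straightens the
    -- parallel hyperplanes.
    rw [← lintegral_add_right_eq_self _ ⟪p, v⟫]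
    simp
  simp_rw [h1]
  rw [lintegral_lintegral_swap hjoint.aemeasurable]
  refine lintegral_congr fun q => ?_
  rw [sliceMeasure, withDensity_apply _ .univ, setLIntegral_univ, mul_comm, lintegral_mul_const]
  exact ((measurable_betaDensity _ _).comp
      (measurable_consPt (by fun_prop) (by fun_prop))).ennreal_ofReal

/-- All Gamma factors except two cancel. This identity turns the total slice mass into a normalised
one-dimensional density with parameter shifted by m/2. -/
lemma betaConst_succ_div {β : ℝ} (hβ : -1 < β) (m : ℕ) :
    betaConst (m + 1) β / betaConst m β = betaConst 1 (β + (m : ℝ) / 2) := by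
  have h1 : 0 < β + 1 := by linarith
  have h2 : 0 < (m : ℝ) / 2 + β + 1 := by
    have : (0 : ℝ) ≤ m := m.cast_nonneg
    linarith
  have h3 := (Real.Gamma_pos_of_pos h1).ne'
  have h4 := (Real.Gamma_pos_of_pos h2).ne'
  have h5 : (((m + 1 : ℕ) : ℝ) / 2) = (m : ℝ) / 2 + 1 / 2 := by push_cast; ring
  have hpi := Real.pi_pos
  have h6 : Real.pi ^ ((m : ℝ) / 2) ≠ 0 := by positivity
  have h7 : Real.pi ^ ((1 : ℝ) / 2) ≠ 0 := by positivity
  have e1 : β + (m : ℝ) / 2 + 1 = (m : ℝ) / 2 + β + 1 := by ring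
  have e2 : ((1 : ℕ) : ℝ) / 2 + (β + (m : ℝ) / 2) + 1 = (m : ℝ) / 2 + 1 / 2 + β + 1 := by
    push_cast; ring
  simp only [betaConst, h5, e1, e2, Real.rpow_add hpi]
  push_cast
  field_simp

/-- The substitution x ↦ (x + 1)/2 leads to Euler's Beta integral with both parameters β + 1;
Legendre's duplication formula reconciles the two normalising constants. -/
lemma lintegral_one_sub_sq_rpow {β : ℝ} (hβ : -1 < β) :
    ∫⁻ x in Set.Ioo (-1 : ℝ) 1, ENNReal.ofReal (betaConst 1 β * (1 - x ^ 2) ^ β) = 1 := by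
  have h1 : 0 < β + 1 := by linarith
  have h0 := lintegral_betaPDF_eq_one h1 h1
  simp only [betaPDF] at h0
  rw [lintegral_mul_add (a := 1 / 2) (by norm_num) (1 / 2)
    (measurable_betaPDFReal _ _).ennreal_ofReal,
    ← lintegral_const_mul' _ _ ENNReal.ofReal_ne_top] at h0
  rw [← h0, ← lintegral_indicator measurableSet_Ioo]
  refine lintegral_congr fun x => ?_
  by_cases hx : x ∈ Set.Ioo (-1 : ℝ) 1
  · rw [Set.indicator_of_mem hx, ← ENNReal.ofReal_mul (abs_nonneg _)]
    congr 1
    obtain ⟨hx1, hx2⟩ := hx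
    have c1 : 0 < 1 / 2 * x + 1 / 2 := by linarith
    have c2 : 0 < 1 - (1 / 2 * x + 1 / 2) := by linarith
    rw [betaPDFReal, if_pos ⟨c1, by linarith⟩, mul_assoc (1 / beta _ _), 
      ← Real.mul_rpow c1.le c2.le]
    have e : (1 / 2 * x + 1 / 2) * (1 - (1 / 2 * x + 1 / 2)) = (1 / 4) * (1 - x ^ 2) := by ring
    have hx3 : 0 ≤ 1 - x ^ 2 := by nlinarith
    rw [e, add_sub_cancel_right, Real.mul_rpow (by norm_num) hx3]
    have hdup := Real.Gamma_mul_Gamma_add_half (β + 1)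
    have hG1 := Real.Gamma_pos_of_pos h1
    have hG2 : 0 < Real.Gamma (β + 1 + (β + 1)) := Real.Gamma_pos_of_pos (by linarith)
    have hG3 : 0 < Real.Gamma (β + 1 + 1 / 2) := Real.Gamma_pos_of_pos (by linarith)
    have e2 : (2 : ℝ) * (β + 1) = β + 1 + (β + 1) := by ring
    have e3 : (2 : ℝ) ^ (1 - (β + 1 + (β + 1))) = (1 / 4 : ℝ) ^ β * (1 / 2) := by
      rw [show (1 / 4 : ℝ) = 2 ^ (-2 : ℝ) by norm_num [Real.rpow_neg], ← Real.rpow_mul (by norm_num),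
        show (1 / 2 : ℝ) = 2 ^ (-1 : ℝ) by norm_num [Real.rpow_neg], ← Real.rpow_add (by norm_num)]
      ring_nf
    rw [e2, e3] at hdup
    have e4 : ((1 : ℕ) : ℝ) / 2 + β + 1 = β + 1 + 1 / 2 := by push_cast; ring
    have hpi : (0 : ℝ) < √Real.pi := Real.sqrt_pos.2 Real.pi_pos
    rw [betaConst, e4, beta, abs_of_pos (by norm_num : (0 : ℝ) < 1 / 2)]
    push_cast
    rw [← Real.sqrt_eq_rpow]
    field_simp
    field_simp at hdup
    linear_combination (1 - x ^ 2) ^ β * hdup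
  · rw [Set.indicator_of_notMem hx, betaPDFReal, if_neg]
    · simp
    · rintro ⟨h2, h3⟩
      exact hx ⟨by linarith, by linarith⟩


/-! ### The height distribution of a beta point and half-space probabilities. -/

/-- The density of the distance to the origin of a hyperplane section, on `(-1, 1)`. -/
def heightDensity (γ h : ℝ) : ℝ := betaConst 1 γ * (1 - h ^ 2) ^ γ

@[fun_prop] lemma measurable_heightDensity (γ : ℝ) : Measurable (heightDensity γ) := by
  unfold heightDensity; fun_prop

lemma heightDensity_nonneg {γ : ℝ} (hγ : -1 < γ) {h : ℝ} (hh : h ∈ Set.Icc (-1 : ℝ) 1) :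
    0 ≤ heightDensity γ h := by
  have h1 := betaConst_pos 1 hγ
  have h2 : 0 ≤ 1 - h ^ 2 := by nlinarith [hh.1, hh.2]
  unfold heightDensity; positivity

lemma sliceMass_eq {β : ℝ} (hβ : -1 < β) (p : Euc m) (q : ℝ) :
    sliceMass p q β = cosGraph p * heightDensity (β + (m : ℝ) / 2) (q * cosGraph p) := by
  rw [sliceMass, heightDensity, betaConst_succ_div hβ, mul_assoc]

/-- The lower-dimensional normalisation is assumed here because this lemma is itself the inductive
step of `isProbabilityMeasure_betaDistribution`. The factor c in the slice mass is the Jacobian of h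
= q c. -/
lemma lintegral_height_of_isProbability {β : ℝ} (hβ : -1 < β)
    [IsProbabilityMeasure (betaDistribution m β)] (p : Euc m) {g : ℝ → ℝ≥0∞}
    (hg : Measurable g) :
    ∫⁻ z, g (z 0 - ⟪p, tailPt z⟫) ∂(betaDistribution (m + 1) β)
      = ∫⁻ h in Set.Ioo (-1 : ℝ) 1, g (h / cosGraph p) *
        ENNReal.ofReal (heightDensity (β + (m : ℝ) / 2) h) := by
  have hs := cosGraph_pos p
  have hmeas : Measurable fun h => (Set.Ioo (-1 : ℝ) 1).indicator (fun h => g (h / cosGraph p) *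
        ENNReal.ofReal (heightDensity (β + (m : ℝ) / 2) h)) h := by
    refine Measurable.indicator ?_ measurableSet_Ioo
    exact (hg.comp (by fun_prop)).mul (by fun_prop)
  rw [lintegral_height_sub p hg, ← lintegral_indicator measurableSet_Ioo,
    lintegral_mul_add hs.ne' 0 hmeas, ← lintegral_const_mul' _ _ ENNReal.ofReal_ne_top]
  -- The two tangent hyperplanes |q c| = 1 are discarded, since there the scaled coordinates on the
  -- section degenerate.
  have hae : ∀ᵐ q : ℝ, q ∉ ({1 / cosGraph p, -1 / cosGraph p} : Set ℝ) :=
    compl_mem_ae_iff.2 ((Set.toFinite _).measure_zero _)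
  refine lintegral_congr_ae ?_
  filter_upwards [hae] with q hq
  simp only [Set.mem_insert_iff, Set.mem_singleton_iff, not_or, eq_div_iff hs.ne'] at hq
  rw [add_zero, mul_comm (cosGraph p) q, abs_of_pos hs]
  rcases lt_trichotomy |q * cosGraph p| 1 with h | h | h
  · have hmem : q * cosGraph p ∈ Set.Ioo (-1 : ℝ) 1 := abs_lt.1 h
    rw [Set.indicator_of_mem hmem, sliceMeasure_eq hβ p q h, Measure.smul_apply,
      Measure.map_apply (measurable_sliceParam p q) .univ, Set.preimage_univ, measure_univ,
      sliceMass_eq hβ, ENNReal.ofReal_mul hs.le, mul_div_cancel_right₀ _ hs.ne']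
    simp only [smul_eq_mul, mul_one]
    ring
  · rcases eq_or_eq_neg_of_abs_eq h with h | h
    · exact absurd h hq.1
    · exact absurd h hq.2
  · rw [sliceMeasure_eq_zero p q h, Set.indicator_of_notMem]
    · simp
    · intro h'
      exact absurd (abs_lt.2 h') (not_lt.2 h.le)

theorem isProbabilityMeasure_betaDistribution (d : ℕ) {β : ℝ} (hβ : -1 < β) :
    IsProbabilityMeasure (betaDistribution d β) := by
  induction d with
  | zero =>
    have h1 : betaDensity 0 β = fun _ => 1 := by
      funext x
      have hG := (Real.Gamma_pos_of_pos (by linarith : 0 < β + 1)).ne'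
      have : x = 0 := Subsingleton.elim _ _
      simp [betaDensity, betaConst, this, hG]
    constructor
    rw [betaDistribution, h1, volume_euclideanSpace_eq_dirac]
    simp
  | succ m ih =>
    constructor
    have hm : (0 : ℝ) ≤ m := m.cast_nonneg
    -- Horizontal slices suffice: the first coordinate then has the one-dimensional beta density
    -- with parameter β + m/2.
    have h := lintegral_height_of_isProbability hβ (0 : Euc m) (g := fun _ => 1) measurable_const
    simp only [lintegral_one, one_mul] at h
    rw [h]
    exact lintegral_one_sub_sq_rpow (by linarith)

theorem lintegral_betaDistribution_height {β : ℝ} (hβ : -1 < β) (p : Euc m) {g : ℝ → ℝ≥0∞}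
    (hg : Measurable g) :
    ∫⁻ z, g (z 0 - ⟪p, tailPt z⟫) ∂(betaDistribution (m + 1) β)
      = ∫⁻ h in Set.Ioo (-1 : ℝ) 1, g (h / cosGraph p) *
        ENNReal.ofReal (heightDensity (β + (m : ℝ) / 2) h) :=
  haveI := isProbabilityMeasure_betaDistribution m hβ
  lintegral_height_of_isProbability hβ p hg

lemma integrableOn_heightDensity {γ : ℝ} (hγ : -1 < γ) :
    IntegrableOn (heightDensity γ) (Set.Ioo (-1 : ℝ) 1) := by
  refine ⟨(measurable_heightDensity γ).aestronglyMeasurable, ?_⟩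
  rw [hasFiniteIntegral_iff_ofReal]
  · exact (lintegral_one_sub_sq_rpow hγ).trans_lt ENNReal.one_lt_top
  · exact (ae_restrict_iff' measurableSet_Ioo).2 (.of_forall fun x hx =>
      heightDensity_nonneg hγ (Set.Ioo_subset_Icc_self hx))

lemma betaCDF_eq (γ h : ℝ) : betaCDF γ h = ∫ x in (-1 : ℝ)..h, heightDensity γ x := by
  rw [betaCDF, ← intervalIntegral.integral_const_mul]; rfl

lemma continuousOn_betaCDF {γ : ℝ} (hγ : -1 < γ) :
    ContinuousOn (betaCDF γ) (Set.Icc (-1 : ℝ) 1) := by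
  have h := intervalIntegral.continuousOn_primitive (a := (-1 : ℝ)) (b := 1)
    ((integrableOn_Icc_iff_integrableOn_Ioo (μ := volume)).2 (integrableOn_heightDensity hγ))
  refine h.congr fun x hx => ?_
  rw [betaCDF_eq, intervalIntegral.integral_of_le hx.1]

lemma ofReal_betaCDF {γ : ℝ} (hγ : -1 < γ) {h : ℝ} (hh : h ∈ Set.Icc (-1 : ℝ) 1) :
    ENNReal.ofReal (betaCDF γ h) =
      ∫⁻ x in Set.Ioo (-1 : ℝ) h, ENNReal.ofReal (heightDensity γ x) := by
  rw [betaCDF_eq, intervalIntegral.integral_of_le hh.1, integral_Ioc_eq_integral_Ioo,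
    ofReal_integral_eq_lintegral_ofReal]
  · exact (integrableOn_heightDensity hγ).mono_set (Set.Ioo_subset_Ioo_right hh.2)
  · exact (ae_restrict_iff' measurableSet_Ioo).2 (.of_forall fun x hx =>
      heightDensity_nonneg hγ ⟨hx.1.le, hx.2.le.trans hh.2⟩)

lemma betaCDF_nonneg {γ : ℝ} (hγ : -1 < γ) {h : ℝ} (hh : h ∈ Set.Icc (-1 : ℝ) 1) :
    0 ≤ betaCDF γ h := by
  rw [betaCDF_eq]
  refine intervalIntegral.integral_nonneg hh.1 fun x hx => ?_
  exact heightDensity_nonneg hγ ⟨hx.1, hx.2.trans hh.2⟩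

lemma betaCDF_le_one {γ : ℝ} (hγ : -1 < γ) {h : ℝ} (hh : h ∈ Set.Icc (-1 : ℝ) 1) :
    betaCDF γ h ≤ 1 := by
  rw [← ENNReal.ofReal_le_one, ofReal_betaCDF hγ hh, ← lintegral_one_sub_sq_rpow hγ]
  exact lintegral_mono_set (Set.Ioo_subset_Ioo_right hh.2)

/-- The probability that a beta distributed point lies below a hyperplane. -/
theorem betaDistribution_below {β : ℝ} (hβ : -1 < β) (p : Euc m) {q : ℝ}
    (hq : |q * cosGraph p| ≤ 1) :
    betaDistribution (m + 1) β {z | z 0 < q + ⟪p, tailPt z⟫}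
      = ENNReal.ofReal (betaCDF (β + (m : ℝ) / 2) (q * cosGraph p)) := by
  have hs := cosGraph_pos p
  have hm : (0 : ℝ) ≤ m := m.cast_nonneg
  have htail := continuous_tailPt (m := m)
  have hset : MeasurableSet {z : Euc (m + 1) | z 0 < q + ⟪p, tailPt z⟫} :=
    measurableSet_lt (by fun_prop) (by fun_prop)
  rw [ofReal_betaCDF (by linarith) (abs_le.1 hq), ← lintegral_indicator_one hset]
  have h := lintegral_betaDistribution_height hβ p (g := (Set.Iio q).indicator 1)
    (measurable_one.indicator measurableSet_Iio)
  have e1 : ∀ z : Euc (m + 1), ({z | z 0 < q + ⟪p, tailPt z⟫} : Set (Euc (m + 1))).indicator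
      (1 : Euc (m + 1) → ℝ≥0∞) z = (Set.Iio q).indicator 1 (z 0 - ⟪p, tailPt z⟫) := by
    intro z
    simp only [Set.indicator_apply, Set.mem_ofPred_eq, Set.mem_Iio, sub_lt_iff_lt_add]
    rfl
  simp_rw [e1]
  rw [h, ← lintegral_indicator measurableSet_Ioo, ← lintegral_indicator measurableSet_Ioo]
  refine lintegral_congr fun x => ?_
  simp only [Set.indicator_apply, Set.mem_Ioo, Set.mem_Iio, div_lt_iff₀ hs]
  have := (abs_le.1 hq).2
  by_cases h1 : -1 < x <;> by_cases h2 : x < q * cosGraph p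
  · simp [h1, h2, h2.trans_le this]
  all_goals simp [h1, h2]

/-- The probability that a beta distributed point lies above a hyperplane. -/
theorem betaDistribution_above {β : ℝ} (hβ : -1 < β) (p : Euc m) {q : ℝ}
    (hq : |q * cosGraph p| ≤ 1) :
    betaDistribution (m + 1) β {z | q + ⟪p, tailPt z⟫ < z 0}
      = ENNReal.ofReal (betaCDF (β + (m : ℝ) / 2) (-(q * cosGraph p))) := by
  have hs := cosGraph_pos p
  have hm : (0 : ℝ) ≤ m := m.cast_nonneg
  have htail := continuous_tailPt (m := m)
  have hset : MeasurableSet {z : Euc (m + 1) | q + ⟪p, tailPt z⟫ < z 0} :=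
    measurableSet_lt (by fun_prop) (by fun_prop)
  have hq' := abs_le.1 hq
  rw [ofReal_betaCDF (by linarith) ⟨by linarith, by linarith⟩, ← lintegral_indicator_one hset]
  have h := lintegral_betaDistribution_height hβ p (g := (Set.Ioi q).indicator 1)
    (measurable_one.indicator measurableSet_Ioi)
  have e1 : ∀ z : Euc (m + 1), ({z | q + ⟪p, tailPt z⟫ < z 0} : Set (Euc (m + 1))).indicator
      (1 : Euc (m + 1) → ℝ≥0∞) z = (Set.Ioi q).indicator 1 (z 0 - ⟪p, tailPt z⟫) := by
    intro z
    simp only [Set.indicator_apply, Set.mem_ofPred_eq, Set.mem_Ioi, lt_sub_iff_add_lt]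
    rfl
  simp_rw [e1]
  -- The height density is even, so reflecting h turns the upper tail into a value of the
  -- distribution function.
  rw [h, ← lintegral_indicator measurableSet_Ioo, ← lintegral_indicator measurableSet_Ioo,
    ← lintegral_neg_eq_self]
  refine lintegral_congr fun x => ?_
  simp only [Set.indicator_apply, Set.mem_Ioo, Set.mem_Ioi, lt_div_iff₀ hs, heightDensity, neg_sq,
    neg_lt_neg_iff, lt_neg (a := q * cosGraph p), neg_lt (a := x) (b := 1)]
  by_cases h1 : -1 < x <;> by_cases h2 : x < -(q * cosGraph p)
  · have : x < 1 := by linarith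
    simp [h1, h2, this]
  all_goals simp [h1, h2]

/-! ### The integral over all slopes. -/

lemma lintegral_abs_pow (n : ℕ) {s : ℝ} (hs : 0 ≤ s) :
    ∫⁻ r in Set.Ioo (-s) s, ENNReal.ofReal (|r| ^ n) = ENNReal.ofReal (2 / (n + 1) * s ^ (n + 1)) := by
  have hc : Continuous fun r : ℝ => |r| ^ n := by fun_prop
  rw [← ofReal_integral_eq_lintegral_ofReal
    (hc.integrableOn_Icc.mono_set Set.Ioo_subset_Icc_self) (.of_forall fun r => by positivity),
    ← integral_Ioc_eq_integral_Ioo, ← intervalIntegral.integral_of_le (by linarith),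
    ← intervalIntegral.integral_add_adjacent_intervals (b := 0) (hc.intervalIntegrable _ _)
      (hc.intervalIntegrable _ _)]
  have h1 : ∫ r in (0 : ℝ)..s, |r| ^ n = s ^ (n + 1) / (n + 1) := by
    rw [intervalIntegral.integral_congr (g := fun r => r ^ n), integral_pow]
    · simp
    · intro r hr
      rw [Set.uIcc_of_le hs] at hr
      simp only [abs_of_nonneg hr.1]
  have h2 : ∫ r in (-s)..0, |r| ^ n = ∫ r in (0 : ℝ)..s, |r| ^ n := by
    have := intervalIntegral.integral_comp_neg (a := 0) (b := s) fun r : ℝ => |r| ^ n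
    simpa using this.symm
  rw [h2, h1]
  congr 1
  ring

/-- The gnomonic parametrisation of the half-sphere, in integrated form. -/
theorem lintegral_cosGraph_pow (m : ℕ) :
    ∫⁻ p : Euc m, ENNReal.ofReal (cosGraph p ^ (m + 1))
      = ENNReal.ofReal ((m + 1) / 2 * unitBallVolume (m + 1)) := by
  have hball : volume (Metric.ball (0 : Euc (m + 1)) 1) =
      ∫⁻ p : Euc m, ENNReal.ofReal (2 / (m + 1) * cosGraph p ^ (m + 1)) := by
    have hm1 : Measurable ((Metric.ball (0 : Euc (m + 1)) 1).indicator (1 : Euc (m + 1) → ℝ≥0∞)) :=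
      measurable_one.indicator measurableSet_ball
    rw [← lintegral_indicator_one measurableSet_ball, lintegral_consPt hm1]
    -- Computing the volume of the ball with v = r p gives the Jacobian |r|^m, and (r, r p) lies in
    -- the ball exactly when |r| < `cosGraph p`. The integral over r then produces the required
    -- power.
    have h1 : ∀ᵐ r : ℝ, ∫⁻ v : Euc m, (Metric.ball (0 : Euc (m + 1)) 1).indicator
        (1 : Euc (m + 1) → ℝ≥0∞) (consPt r v) = ∫⁻ p : Euc m, ENNReal.ofReal (|r| ^ m) *
          (Metric.ball (0 : Euc (m + 1)) 1).indicator (1 : Euc (m + 1) → ℝ≥0∞) (consPt r (r • p)) := by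
      have : ∀ᵐ r : ℝ, r ≠ 0 := compl_mem_ae_iff.2 (measure_singleton 0)
      filter_upwards [this] with r hr
      have hdet : LinearMap.det (r • LinearMap.id : Euc m →ₗ[ℝ] Euc m) = r ^ m := by
        simp [LinearMap.det_smul]
      rw [lintegral_linearMap_add (A := r • LinearMap.id) (by rw [hdet]; positivity) 0
        (f := fun v => (Metric.ball (0 : Euc (m + 1)) 1).indicator 1 (consPt r v))
        (hm1.comp (measurable_consPt measurable_const measurable_id)), hdet, abs_pow,
        lintegral_const_mul' _ _ ENNReal.ofReal_ne_top]
      simp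
    rw [lintegral_congr_ae h1, lintegral_lintegral_swap]
    · refine lintegral_congr fun p => ?_
      have hs := cosGraph_pos p
      have h2 := cosGraph_sq p
      rw [← lintegral_abs_pow m hs.le, ← lintegral_indicator measurableSet_Ioo]
      refine lintegral_congr fun r => ?_
      have hiff : consPt r (r • p) ∈ Metric.ball (0 : Euc (m + 1)) 1
          ↔ r ∈ Set.Ioo (-cosGraph p) (cosGraph p) := by
        rw [mem_ball_zero_iff, ← sq_lt_one_iff₀ (norm_nonneg _), norm_sq_consPt, norm_smul, mul_pow,
          Real.norm_eq_abs, sq_abs, Set.mem_Ioo, ← abs_lt]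
        nth_rewrite 1 [← abs_of_pos hs]
        rw [← sq_lt_sq]
        have hp : 0 < 1 + ‖p‖ ^ 2 := by positivity
        rw [← mul_lt_mul_iff_left₀ hp (b := r ^ 2) (c := cosGraph p ^ 2), h2, mul_add, mul_one]
      by_cases h : r ∈ Set.Ioo (-cosGraph p) (cosGraph p)
      · rw [Set.indicator_of_mem h, Set.indicator_of_mem (hiff.2 h)]; simp
      · rw [Set.indicator_of_notMem h, Set.indicator_of_notMem (mt hiff.1 h)]; simp
    · refine Measurable.aemeasurable (Measurable.mul (by fun_prop) ?_)
      exact hm1.comp (measurable_consPt (by fun_prop) (by fun_prop))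
  have hm : (0 : ℝ) < (m : ℝ) + 1 := by positivity
  have h2 : ∀ p : Euc m, ENNReal.ofReal (2 / (m + 1) * cosGraph p ^ (m + 1)) =
      ENNReal.ofReal (2 / (m + 1)) * ENNReal.ofReal (cosGraph p ^ (m + 1)) :=
    fun p => ENNReal.ofReal_mul (by positivity)
  simp_rw [h2] at hball
  rw [lintegral_const_mul' _ _ ENNReal.ofReal_ne_top] at hball
  rw [ENNReal.ofReal_mul (by positivity), unitBallVolume, ofReal_measureReal measure_ball_lt_top.ne,
    hball, ← mul_assoc, ← ENNReal.ofReal_mul (by positivity)]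
  field_simp
  simp

/-! ### The expected contribution of one random simplex. -/

lemma pi_betaDistribution {ι : Type*} [Fintype ι] (d : ℕ) (γ : ι → ℝ) :
    Measure.pi (fun i => betaDistribution d (γ i)) =
      volume.withDensity fun x => ∏ i, ENNReal.ofReal (betaDensity d (γ i) (x i)) :=
  haveI : ∀ i : ι, SigmaFinite ((volume : Measure (Euc d)).withDensity
      fun x => ENNReal.ofReal (betaDensity d (γ i) x)) := fun _ => SigmaFinite.withDensity_ofReal _
  pi_withDensity (fun _ => volume) (fun i x => ENNReal.ofReal (betaDensity d (γ i) x))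
    fun _ => by fun_prop

instance (p : Euc m) (q β : ℝ) : SigmaFinite (sliceMeasure p q β) := by
  unfold sliceMeasure
  exact SigmaFinite.withDensity_ofReal _

lemma measurable_slice_density (p : Euc m) (q β : ℝ) : Measurable fun t : Euc m =>
    ENNReal.ofReal (betaDensity (m + 1) β (consPt (q + ⟪p, t⟫) t)) :=
  ((measurable_betaDensity _ _).comp (measurable_consPt (by fun_prop) (by fun_prop))).ennreal_ofReal

lemma pi_sliceMeasure {ι : Type*} [Fintype ι] (p : Euc m) (q : ℝ) (γ : ι → ℝ) :
    Measure.pi (fun i => sliceMeasure p q (γ i)) =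
      volume.withDensity fun t : ι → Euc m => ∏ i,
        ENNReal.ofReal (betaDensity (m + 1) (γ i) (consPt (q + ⟪p, t i⟫) (t i))) :=
  haveI : ∀ i : ι, SigmaFinite ((volume : Measure (Euc m)).withDensity
      fun t => ENNReal.ofReal (betaDensity (m + 1) (γ i) (consPt (q + ⟪p, t⟫) t))) :=
    fun _ => SigmaFinite.withDensity_ofReal _
  pi_withDensity (fun _ => volume)
    (fun i t => ENNReal.ofReal (betaDensity (m + 1) (γ i) (consPt (q + ⟪p, t⟫) t)))
    fun _ => measurable_slice_density _ _ _

lemma pi_sliceMeasure_eq {ι : Type*} [Fintype ι] {γ : ι → ℝ} (hγ : ∀ i, -1 < γ i) (p : Euc m)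
    (q : ℝ) (hq : |q * cosGraph p| < 1) :
    Measure.pi (fun i => sliceMeasure p q (γ i)) =
      (∏ i, ENNReal.ofReal (sliceMass p q (γ i))) •
        (Measure.pi fun i => betaDistribution m (γ i)).map fun y i => sliceParam p q (y i) := by
  have hmeas : Measurable fun (y : ι → Euc m) i => sliceParam p q (y i) :=
    measurable_pi_lambda _ fun i => (measurable_sliceParam p q).comp (measurable_pi_apply i)
  refine Measure.pi_eq fun s hs => ?_
  have hpre : (fun (y : ι → Euc m) i => sliceParam p q (y i)) ⁻¹' Set.univ.pi s =
      Set.univ.pi fun i => sliceParam p q ⁻¹' s i := by ext; simp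
  rw [Measure.smul_apply, Measure.map_apply hmeas (.univ_pi hs), hpre, Measure.pi_pi, smul_eq_mul,
    ← Finset.prod_mul_distrib]
  refine Finset.prod_congr rfl fun i _ => ?_
  rw [sliceMeasure_eq (hγ i) p q hq, Measure.smul_apply,
    Measure.map_apply (measurable_sliceParam p q) (hs i), smul_eq_mul]

/-- Needed to combine v and v^b into v^(b+1): for real powers at v = 0 this can fail, for instance
when b = -1. -/
lemma ae_simplexVol_pos (γ : Fin (m + 1) → ℝ) :
    ∀ᵐ y ∂(Measure.pi fun i => betaDistribution m (γ i)), 0 < simplexVol y := by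
  rw [pi_betaDistribution]
  refine (withDensity_absolutelyContinuous _ _).ae_le ?_
  filter_upwards [ae_simplexDet_ne_zero] with y hy
  rw [simplexVol_eq]
  positivity

lemma ae_norm_le_one (d : ℕ) (β : ℝ) : ∀ᵐ x ∂(betaDistribution d β), ‖x‖ ≤ 1 := by
  have hs : MeasurableSet {x : Euc d | ‖x‖ ≤ 1} := measurableSet_le measurable_norm measurable_const
  rw [ae_iff, betaDistribution]
  have : {a : Euc d | ¬‖a‖ ≤ 1} = {x : Euc d | ‖x‖ ≤ 1}ᶜ := rfl
  rw [this, withDensity_apply _ hs.compl, ← lintegral_indicator hs.compl]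
  convert! lintegral_zero with x
  rw [Set.indicator_apply]
  split_ifs with h
  · simp only [Set.mem_compl_iff, Set.mem_ofPred_eq] at h
    simp [betaDensity, h]
  · rfl

/-- The points lie in the unit ball, so the volume is bounded and, the exponent being nonnegative,
the moment is finite. -/
lemma ofReal_betaVolumeMoment {γ : Fin (m + 1) → ℝ} (hγ : ∀ i, -1 < γ i) {s : ℝ} (hs : 0 ≤ s) :
    ENNReal.ofReal (betaVolumeMoment m γ s) =
      ∫⁻ y, ENNReal.ofReal (simplexVol y ^ s) ∂(Measure.pi fun i => betaDistribution m (γ i)) := by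
  have hp : ∀ i, IsProbabilityMeasure (betaDistribution m (γ i)) :=
    fun i => isProbabilityMeasure_betaDistribution m (hγ i)
  have hmeas : Measurable fun y : Fin (m + 1) → Euc m => simplexVol y ^ s := by fun_prop
  have hbd : ∀ᵐ y ∂(Measure.pi fun i => betaDistribution m (γ i)),
      ‖simplexVol y ^ s‖ ≤ volume.real (Metric.closedBall (0 : Euc m) 1) ^ s := by
    have : ∀ᵐ y ∂(Measure.pi fun i => betaDistribution m (γ i)), ∀ i, ‖y i‖ ≤ 1 :=
      ae_all_iff.2 fun i =>
        (Measure.quasiMeasurePreserving_eval (fun i => betaDistribution m (γ i)) i).ae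
          (ae_norm_le_one m (γ i))
    filter_upwards [this] with y hy
    have h0 := simplexVol_nonneg y
    rw [Real.norm_of_nonneg (by positivity)]
    refine Real.rpow_le_rpow h0 ?_ hs
    refine measureReal_mono ?_ (isCompact_closedBall _ _).measure_ne_top
    refine convexHull_min ?_ (convex_closedBall _ _)
    rintro _ ⟨i, rfl⟩
    simpa using hy i
  have hint : Integrable (fun y : Fin (m + 1) → Euc m => simplexVol y ^ s)
      (Measure.pi fun i => betaDistribution m (γ i)) :=
    Integrable.of_bound hmeas.aestronglyMeasurable _ hbd
  rw [betaVolumeMoment]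
  exact ofReal_integral_eq_lintegral_ofReal hint
    (.of_forall fun y => Real.rpow_nonneg (simplexVol_nonneg y) s)

lemma simplexVol_sliceParam (p : Euc m) (q : ℝ) (hq : |q * cosGraph p| < 1)
    (y : Fin (m + 1) → Euc m) :
    simplexVol (fun i => sliceParam p q (y i)) =
      (1 - (q * cosGraph p) ^ 2) ^ ((m : ℝ) / 2) * cosGraph p * simplexVol y := by
  have hs := cosGraph_pos p
  have hpos : 0 < 1 - (q * cosGraph p) ^ 2 := by
    have := (sq_lt_one_iff_abs_lt_one (q * cosGraph p)).2 hq; linarith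
  simp_rw [sliceParam_eq]
  rw [simplexVol_image, det_sliceParam, abs_of_pos (by positivity), Real.sqrt_eq_rpow,
    ← Real.rpow_natCast, ← Real.rpow_mul hpos.le]
  ring_nf

/-- The contribution `dist(H, 0)^a * Vol(F)^b` of the simplex `F` in the graph `H` of
`q + ⟪p, ·⟫` whose projection to `ℝ^m` has volume `v`. -/
def facetWeight (a b : ℝ) (p : Euc m) (q v : ℝ) : ℝ := |q * cosGraph p| ^ a * (v / cosGraph p) ^ b

/-- Counting powers: the m + 1 slice masses give c^(m+1) and an exponent m/2 of 1 - h² each; the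
Jacobian volume gives one more c and m/2; the facet volume, already divided by c, contributes only b
m/2. -/
lemma lintegral_slice_facetWeight {γ : Fin (m + 1) → ℝ} (hγ : ∀ i, -1 < γ i) {a b : ℝ}
    (hb : -1 ≤ b) (p : Euc m) (q : ℝ) (hq : |q * cosGraph p| < 1) :
    ∫⁻ t, ENNReal.ofReal (m.factorial * simplexVol t * facetWeight a b p q (simplexVol t))
        ∂(Measure.pi fun i => sliceMeasure p q (γ i)) =
      ENNReal.ofReal (m.factorial * ∏ i, (betaConst (m + 1) (γ i) / betaConst m (γ i))) *
        ENNReal.ofReal (betaVolumeMoment m γ (b + 1)) *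
        (ENNReal.ofReal (cosGraph p ^ (m + 2)) *
          ENNReal.ofReal (|q * cosGraph p| ^ a * (1 - (q * cosGraph p) ^ 2) ^
            (∑ i, γ i + (m : ℝ) / 2 * (m + 1 + b + 1)))) := by
  have hs := cosGraph_pos p
  have hpos : 0 < 1 - (q * cosGraph p) ^ 2 := by
    have := (sq_lt_one_iff_abs_lt_one (q * cosGraph p)).2 hq; linarith
  have hmeas : Measurable fun (y : Fin (m + 1) → Euc m) i => sliceParam p q (y i) :=
    measurable_pi_lambda _ fun i => (measurable_sliceParam p q).comp (measurable_pi_apply i)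
  have hc : ∀ i, 0 < betaConst (m + 1) (γ i) / betaConst m (γ i) :=
    fun i => div_pos (betaConst_pos _ (hγ i)) (betaConst_pos _ (hγ i))
  rw [pi_sliceMeasure_eq hγ p q hq, lintegral_smul_measure, lintegral_map (by
    unfold facetWeight; fun_prop) hmeas]
  set w := 1 - (q * cosGraph p) ^ 2 with hw
  have h1 : ∀ᵐ y ∂(Measure.pi fun i => betaDistribution m (γ i)),
      ENNReal.ofReal (m.factorial * simplexVol (fun i => sliceParam p q (y i)) *
        facetWeight a b p q (simplexVol fun i => sliceParam p q (y i))) =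
      ENNReal.ofReal (m.factorial * cosGraph p * |q * cosGraph p| ^ a *
        w ^ ((m : ℝ) / 2 * (b + 1))) * ENNReal.ofReal (simplexVol y ^ (b + 1)) := by
    filter_upwards [ae_simplexVol_pos γ] with y hy
    rw [← ENNReal.ofReal_mul (by positivity)]
    congr 1
    rw [simplexVol_sliceParam p q hq, facetWeight, ← hw]
    have e1 : w ^ ((m : ℝ) / 2) * cosGraph p * simplexVol y / cosGraph p
      = w ^ ((m : ℝ) / 2) * simplexVol y := by field_simp
    rw [e1, Real.mul_rpow (by positivity) hy.le, ← Real.rpow_mul hpos.le, Real.rpow_add_one hy.ne',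
      mul_add_one, Real.rpow_add hpos]
    ring
  rw [lintegral_congr_ae h1, lintegral_const_mul' _ _ ENNReal.ofReal_ne_top,
    ← ofReal_betaVolumeMoment hγ (by linarith), smul_eq_mul,
    ← ENNReal.ofReal_prod_of_nonneg (fun i _ => by
      have := hc i
      unfold sliceMass; positivity)]
  have e2 : ∏ i, sliceMass p q (γ i) = cosGraph p ^ (m + 1) *
      (∏ i, (betaConst (m + 1) (γ i) / betaConst m (γ i))) *
        w ^ (∑ i, γ i + (m + 1) * ((m : ℝ) / 2)) := by
    simp only [sliceMass, Finset.prod_mul_distrib, Finset.prod_const, Finset.card_univ,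
      Fintype.card_fin, ← hw]
    rw [← Real.rpow_sum_of_pos hpos, Finset.sum_add_distrib]
    simp
  have hP : 0 < ∏ i, (betaConst (m + 1) (γ i) / betaConst m (γ i)) :=
    Finset.prod_pos fun i _ => hc i
  have e3 : ∑ i, γ i + (m : ℝ) / 2 * (m + 1 + b + 1) =
    (∑ i, γ i + (m + 1) * ((m : ℝ) / 2)) + (m : ℝ) / 2 * (b + 1) := by ring
  have e4 : ENNReal.ofReal (∏ i, sliceMass p q (γ i)) * ENNReal.ofReal (m.factorial * cosGraph p *
      |q * cosGraph p| ^ a * w ^ ((m : ℝ) / 2 * (b + 1))) =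
      ENNReal.ofReal (m.factorial * ∏ i, (betaConst (m + 1) (γ i) / betaConst m (γ i))) *
      (ENNReal.ofReal (cosGraph p ^ (m + 2)) * ENNReal.ofReal (|q * cosGraph p| ^ a * w ^
            (∑ i, γ i + (m : ℝ) / 2 * (m + 1 + b + 1)))) := by
    rw [e2, ← ENNReal.ofReal_mul (by positivity), ← ENNReal.ofReal_mul (by positivity),
      ← ENNReal.ofReal_mul (by positivity), e3, Real.rpow_add hpos _ ((m : ℝ) / 2 * (b + 1))]
    congr 1
    ring
  rw [← mul_assoc, e4]
  ring

@[fun_prop] lemma measurable_facetWeight {α : Type*} [MeasurableSpace α] (a b : ℝ) {f : α → Euc m}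
    {g h : α → ℝ} (hf : Measurable f) (hg : Measurable g) (hh : Measurable h) :
    Measurable fun z => facetWeight a b (f z) (g z) (h z) := by
  have h1 : Measurable fun z => cosGraph (f z) := continuous_cosGraph.measurable.comp hf
  unfold facetWeight
  fun_prop

lemma measurable_graphCoef_zero : Measurable fun x : Fin (m + 1) → Euc (m + 1) => graphCoef x 0 :=
  (by fun_prop : Measurable fun z : Euc (m + 1) => z 0).comp measurable_graphCoef

lemma measurable_tailPt_graphCoef :
    Measurable fun x : Fin (m + 1) → Euc (m + 1) => tailPt (graphCoef x) :=
  continuous_tailPt.measurable.comp measurable_graphCoef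

lemma measurable_facetWeight_graphCoef (a b : ℝ) : Measurable fun x : Fin (m + 1) → Euc (m + 1) =>
    facetWeight a b (tailPt (graphCoef x)) (graphCoef x 0) (simplexVol fun i => tailPt (x i)) :=
  measurable_facetWeight a b measurable_tailPt_graphCoef measurable_graphCoef_zero
    (measurable_simplexVol.comp (by have := continuous_tailPt (m := m); fun_prop))

/-- The expected contribution of a simplex spanned by independent beta distributed points, times a
function of its affine hull. -/
theorem lintegral_facetWeight {γ : Fin (m + 1) → ℝ} (hγ : ∀ i, -1 < γ i) {a b : ℝ}
    (hb : -1 ≤ b) {F : Euc m → ℝ → ℝ≥0∞} (hF : Measurable (Function.uncurry F))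
    {g : ℝ → ℝ≥0∞} (hFg : ∀ p q, |q * cosGraph p| < 1 → F p q = g (q * cosGraph p)) :
    ∫⁻ x, ENNReal.ofReal (facetWeight a b (tailPt (graphCoef x)) (graphCoef x 0)
        (simplexVol fun i => tailPt (x i))) * F (tailPt (graphCoef x)) (graphCoef x 0)
        ∂(Measure.pi fun i => betaDistribution (m + 1) (γ i)) =
      ENNReal.ofReal (m.factorial * ((m + 1) / 2 * unitBallVolume (m + 1)) *
          ∏ i, (betaConst (m + 1) (γ i) / betaConst m (γ i))) *
        ENNReal.ofReal (betaVolumeMoment m γ (b + 1)) *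
        ∫⁻ h in Set.Ioo (-1 : ℝ) 1, ENNReal.ofReal (|h| ^ a * (1 - h ^ 2) ^
            (∑ i, γ i + (m : ℝ) / 2 * (m + 1 + b + 1))) * g h := by
  have hW : Measurable fun x : Fin (m + 1) → Euc (m + 1) =>
      ENNReal.ofReal (facetWeight a b (tailPt (graphCoef x)) (graphCoef x 0)
        (simplexVol fun i => tailPt (x i))) := (measurable_facetWeight_graphCoef a b).ennreal_ofReal
  have hFx : Measurable fun x : Fin (m + 1) → Euc (m + 1) =>
      F (tailPt (graphCoef x)) (graphCoef x 0) :=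
    hF.comp (measurable_tailPt_graphCoef.prodMk measurable_graphCoef_zero)
  have hD : Measurable fun x : Fin (m + 1) → Euc (m + 1) =>
      ∏ i, ENNReal.ofReal (betaDensity (m + 1) (γ i) (x i)) := by fun_prop
  let H : (Fin (m + 1) → Euc (m + 1)) → ℝ≥0∞ := fun x =>
    (∏ i, ENNReal.ofReal (betaDensity (m + 1) (γ i) (x i))) *
      (ENNReal.ofReal (facetWeight a b (tailPt (graphCoef x)) (graphCoef x 0)
        (simplexVol fun i => tailPt (x i))) * F (tailPt (graphCoef x)) (graphCoef x 0))
  have hH : Measurable H := hD.mul (hW.mul hFx)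
  rw [pi_betaDistribution]
  refine (lintegral_withDensity_eq_lintegral_mul _ hD (hW.mul hFx)).trans ?_
  refine (lintegral_hyperplane hH).trans ?_
  -- One of the m + 2 factors c is set apart to become dh = c dq; the remaining m + 1 are what
  -- `lintegral_cosGraph_pow` integrates.
  have hinner : ∀ p : Euc m, ∀ᵐ q : ℝ, ∫⁻ t : Fin (m + 1) → Euc m, ENNReal.ofReal |simplexDet t| *
      H (fun i => consPt (q + ⟪p, t i⟫) (t i)) =
      ENNReal.ofReal (m.factorial * ∏ i, (betaConst (m + 1) (γ i) / betaConst m (γ i))) *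
        ENNReal.ofReal (betaVolumeMoment m γ (b + 1)) *
        (ENNReal.ofReal (cosGraph p ^ (m + 1)) * (ENNReal.ofReal (cosGraph p) *
          (Set.Ioo (-1 : ℝ) 1).indicator (fun h => ENNReal.ofReal (|h| ^ a * (1 - h ^ 2) ^
            (∑ i, γ i + (m : ℝ) / 2 * (m + 1 + b + 1))) * g h) (q * cosGraph p))) := by
    intro p
    have hs := cosGraph_pos p
    have hae : ∀ᵐ q : ℝ, q ∉ ({1 / cosGraph p, -1 / cosGraph p} : Set ℝ) :=
      compl_mem_ae_iff.2 ((Set.toFinite _).measure_zero _)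
    filter_upwards [hae] with q hq
    simp only [Set.mem_insert_iff, Set.mem_singleton_iff, not_or, eq_div_iff hs.ne'] at hq
    have hVm : Measurable fun t : Fin (m + 1) → Euc m =>
        ENNReal.ofReal (m.factorial * simplexVol t * facetWeight a b p q (simplexVol t)) := by
      unfold facetWeight; fun_prop
    have hDm : Measurable fun t : Fin (m + 1) → Euc m => ∏ i,
        ENNReal.ofReal (betaDensity (m + 1) (γ i) (consPt (q + ⟪p, t i⟫) (t i))) :=
      Finset.measurable_fun_prod _ fun i _ =>
        (measurable_slice_density p q (γ i)).comp (measurable_pi_apply i)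
    have h1 : ∫⁻ t : Fin (m + 1) → Euc m, ENNReal.ofReal |simplexDet t| *
      H (fun i => consPt (q + ⟪p, t i⟫) (t i)) =
        (∫⁻ t, ENNReal.ofReal (m.factorial * simplexVol t * facetWeight a b p q (simplexVol t))
        ∂(Measure.pi fun i => sliceMeasure p q (γ i))) * F p q := by
      rw [pi_sliceMeasure, lintegral_withDensity_eq_lintegral_mul _ hDm hVm,
        ← lintegral_mul_const _ (hDm.mul hVm)]
      refine lintegral_congr_ae ?_
      filter_upwards [ae_simplexDet_ne_zero] with t ht
      have hdet : |simplexDet t| = m.factorial * simplexVol t := by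
        rw [simplexVol_eq]; field_simp
      simp only [H, Pi.mul_apply, graphCoef_consPt ht, tailPt_consPt, consPt_zero]
      rw [hdet, ENNReal.ofReal_mul (p := m.factorial * simplexVol t) (by
        have := simplexVol_nonneg t; positivity)]
      ring
    rw [h1]
    rcases lt_trichotomy |q * cosGraph p| 1 with h | h | h
    · have hmem : q * cosGraph p ∈ Set.Ioo (-1 : ℝ) 1 := abs_lt.1 h
      rw [Set.indicator_of_mem hmem, lintegral_slice_facetWeight hγ hb p q h, hFg p q h, pow_succ
        (cosGraph p) (m + 1), ENNReal.ofReal_mul (p := cosGraph p ^ (m + 1)) (by positivity)]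
      ring
    · rcases eq_or_eq_neg_of_abs_eq h with h | h
      · exact absurd h hq.1
      · exact absurd h hq.2
    · have hmem : q * cosGraph p ∉ Set.Ioo (-1 : ℝ) 1 := fun h' =>
        absurd (abs_lt.2 h') (not_lt.2 h.le)
      have hz : Measure.pi (fun i => sliceMeasure p q (γ i)) = 0 := by
        rw [← Measure.measure_univ_eq_zero, Measure.pi_univ]
        exact Finset.prod_eq_zero (Finset.mem_univ 0) (by rw [sliceMeasure_eq_zero p q h]; simp)
      rw [Set.indicator_of_notMem hmem, hz]
      simp
  have houter : ∀ p : Euc m, ∫⁻ q : ℝ, ENNReal.ofReal (cosGraph p) *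
          (Set.Ioo (-1 : ℝ) 1).indicator (fun h => ENNReal.ofReal (|h| ^ a * (1 - h ^ 2) ^
            (∑ i, γ i + (m : ℝ) / 2 * (m + 1 + b + 1))) * g h) (q * cosGraph p) =
      ∫⁻ h in Set.Ioo (-1 : ℝ) 1, ENNReal.ofReal (|h| ^ a * (1 - h ^ 2) ^
            (∑ i, γ i + (m : ℝ) / 2 * (m + 1 + b + 1))) * g h := by
    intro p
    have hs := cosGraph_pos p
    -- At p = 0 one has c = 1, so on (-1, 1) the function g is a section of F and inherits its
    -- measurability.
    have hg : Measurable ((Set.Ioo (-1 : ℝ) 1).indicator g) := by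
      have h2 : (Set.Ioo (-1 : ℝ) 1).indicator g = (Set.Ioo (-1 : ℝ) 1).indicator (F 0) := by
        funext h
        by_cases hh : h ∈ Set.Ioo (-1 : ℝ) 1
        · have h0 : cosGraph (0 : Euc m) = 1 := by simp [cosGraph]
          have := hFg 0 h (by rw [h0, mul_one]; exact abs_lt.2 hh)
          rw [h0, mul_one] at this
          rw [Set.indicator_of_mem hh, Set.indicator_of_mem hh, this]
        · rw [Set.indicator_of_notMem hh, Set.indicator_of_notMem hh]
      rw [h2]
      exact (hF.comp (f := fun h : ℝ => ((0 : Euc m), h)) (by fun_prop)).indicator measurableSet_Ioo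
    have hK : Measurable ((Set.Ioo (-1 : ℝ) 1).indicator (fun h =>
        ENNReal.ofReal (|h| ^ a * (1 - h ^ 2) ^
          (∑ i, γ i + (m : ℝ) / 2 * (m + 1 + b + 1))) * g h)) := by
      have h3 : ((Set.Ioo (-1 : ℝ) 1).indicator (fun h => ENNReal.ofReal (|h| ^ a * (1 - h ^ 2) ^
            (∑ i, γ i + (m : ℝ) / 2 * (m + 1 + b + 1))) * g h)) = fun h =>
          ENNReal.ofReal (|h| ^ a * (1 - h ^ 2) ^
            (∑ i, γ i + (m : ℝ) / 2 * (m + 1 + b + 1))) * (Set.Ioo (-1 : ℝ) 1).indicator g h := by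
        funext h
        rw [Set.indicator_mul_right]
      rw [h3]
      fun_prop
    rw [← lintegral_indicator measurableSet_Ioo]
    conv_rhs => rw [lintegral_mul_add hs.ne' 0 hK, ← lintegral_const_mul' _ _ ENNReal.ofReal_ne_top,
      abs_of_pos hs]
    simp_rw [add_zero, mul_comm (cosGraph p)]
  calc _ = ∫⁻ p : Euc m, ENNReal.ofReal (m.factorial *
          ∏ i, (betaConst (m + 1) (γ i) / betaConst m (γ i))) *
        ENNReal.ofReal (betaVolumeMoment m γ (b + 1)) *
        (ENNReal.ofReal (cosGraph p ^ (m + 1)) *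
        ∫⁻ h in Set.Ioo (-1 : ℝ) 1, ENNReal.ofReal (|h| ^ a * (1 - h ^ 2) ^
            (∑ i, γ i + (m : ℝ) / 2 * (m + 1 + b + 1))) * g h) := by
        refine lintegral_congr fun p => ?_
        rw [lintegral_congr_ae (hinner p), lintegral_const_mul' _ _
          (ENNReal.mul_ne_top ENNReal.ofReal_ne_top ENNReal.ofReal_ne_top),
          lintegral_const_mul' _ _ ENNReal.ofReal_ne_top, houter]
    _ = _ := by
        have hP : 0 < ∏ i, (betaConst (m + 1) (γ i) / betaConst m (γ i)) :=
          Finset.prod_pos fun i _ => div_pos (betaConst_pos _ (hγ i)) (betaConst_pos _ (hγ i))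
        rw [lintegral_const_mul' _ _
          (ENNReal.mul_ne_top ENNReal.ofReal_ne_top ENNReal.ofReal_ne_top),
          lintegral_mul_const _ (by fun_prop), lintegral_cosGraph_pow]
        have e : (m.factorial : ℝ) * ((m + 1) / 2 * unitBallVolume (m + 1)) *
          ∏ i, (betaConst (m + 1) (γ i) / betaConst m (γ i)) = (m.factorial *
          ∏ i, (betaConst (m + 1) (γ i) / betaConst m (γ i))) *
            ((m + 1) / 2 * unitBallVolume (m + 1)) := by ring
        rw [e, ENNReal.ofReal_mul (p := m.factorial * _) (by positivity)]
        ring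


/-! ### Distance and volume of a simplex in a graph hyperplane. -/

/-- An affine dependence, having weights of sum 0, is a vector in the left kernel of `simplexMatrix
t`; the column of ones encodes the sum. -/
lemma affineIndependent_of_simplexDet_ne_zero {t : Fin (m + 1) → Euc m} (ht : simplexDet t ≠ 0) :
    AffineIndependent ℝ t := by
  rw [affineIndependent_iff]
  intro s w hw hwt i hi
  have h : Matrix.vecMul (fun i => if i ∈ s then w i else 0) (simplexMatrix t) = 0 := by
    ext j
    refine Fin.cases ?_ (fun j => ?_) j
    · simpa [Matrix.vecMul, dotProduct, simplexMatrix, Finset.sum_ite_mem] using hw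
    · have := congrArg (fun v : Euc m => v j) hwt
      simpa [Matrix.vecMul, dotProduct, simplexMatrix, Finset.sum_ite_mem, ite_mul] using this
  have := congrFun (Matrix.eq_zero_of_vecMul_eq_zero ht h) i
  simpa [hi] using this

lemma surjective_graphParam (p : Euc m) (q : ℝ) : Function.Surjective (graphParam p q) := by
  intro t
  have hdet : LinearMap.det (graphMap p) ≠ 0 := by rw [det_graphMap]; exact (cosGraph_pos p).ne'
  obtain ⟨s, hs⟩ := (LinearMap.equivOfDetNeZero (graphMap p) hdet).surjective
    (t + (q * cosGraph p ^ 2) • p)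
  refine ⟨s, ?_⟩
  have hs' : graphMap p s = t + (q * cosGraph p ^ 2) • p := hs
  simp [graphParam, hs']

/-- The isometric parametrisation of the graph of `q + ⟪p, ·⟫`. -/
def graphIsometry (p : Euc m) (q : ℝ) : Euc m →ᵃⁱ[ℝ] Euc (m + 1) :=
  (isometry_graph p q).affineIsometryOfStrictConvexSpace

lemma graphIsometry_apply (p : Euc m) (q : ℝ) (s : Euc m) :
    graphIsometry p q s = consPt (q + ⟪p, graphParam p q s⟫) (graphParam p q s) := rfl

lemma mem_range_graphIsometry (p : Euc m) (q : ℝ) (z : Euc (m + 1)) :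
    z ∈ Set.range (graphIsometry p q) ↔ z 0 = q + ⟪p, tailPt z⟫ := by
  constructor
  · rintro ⟨s, rfl⟩
    simp [graphIsometry_apply]
  · intro h
    obtain ⟨s, hs⟩ := surjective_graphParam p q (tailPt z)
    refine ⟨s, ?_⟩
    rw [graphIsometry_apply, hs, ← h, consPt_tailPt]

/-- Intrinsic orthonormal coordinates s for the vertices. Projection along the first axis multiplies
volume by the determinant of `graphMap`, which is the cosine. -/
lemma exists_graphIsometry_eq {x : Fin (m + 1) → Euc (m + 1)}
    (hx : simplexDet (fun i => tailPt (x i)) ≠ 0) :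
    ∃ s : Fin (m + 1) → Euc m,
      (∀ i, x i = graphIsometry (tailPt (graphCoef x)) (graphCoef x 0) (s i)) ∧
      simplexVol (fun i => tailPt (x i)) = cosGraph (tailPt (graphCoef x)) * simplexVol s := by
  set p := tailPt (graphCoef x)
  set q := graphCoef x 0
  have h1 : ∀ i, ∃ s, graphIsometry p q s = x i := fun i =>
    (mem_range_graphIsometry p q (x i)).2 (height_eq_graphCoef hx i)
  choose s hs using h1
  refine ⟨s, fun i => (hs i).symm, ?_⟩
  have h2 : (fun i => tailPt (x i)) = fun i => graphMap p (s i) + -((q * cosGraph p ^ 2) • p) := by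
    funext i
    rw [← hs i, graphIsometry_apply, tailPt_consPt, graphParam, sub_eq_add_neg]
  rw [h2, simplexVol_image, det_graphMap, abs_of_pos (cosGraph_pos p)]

lemma simplexDet_ne_zero_iff (t : Fin (m + 1) → Euc m) : simplexDet t ≠ 0 ↔ simplexVol t ≠ 0 := by
  rw [simplexVol_eq]
  have : (m.factorial : ℝ) ≠ 0 := by positivity
  simp [this]

/-- The affine hull of points in general position is a graph. -/
lemma mem_affineSpan_range_iff {x : Fin (m + 1) → Euc (m + 1)}
    (hx : simplexDet (fun i => tailPt (x i)) ≠ 0) (z : Euc (m + 1)) :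
    z ∈ affineSpan ℝ (Set.range x) ↔
      z 0 = graphCoef x 0 + ⟪tailPt (graphCoef x), tailPt z⟫ := by
  obtain ⟨s, hs, hv⟩ := exists_graphIsometry_eq hx
  have hs0 : simplexDet s ≠ 0 := by
    rw [simplexDet_ne_zero_iff] at hx ⊢
    rw [hv] at hx
    exact right_ne_zero_of_mul hx
  have htop : affineSpan ℝ (Set.range s) = ⊤ :=
    (affineIndependent_of_simplexDet_ne_zero hs0).affineSpan_eq_top_iff_card_eq_finrank_add_one.2
      (by simp)
  have hr : Set.range x =
      (graphIsometry (tailPt (graphCoef x)) (graphCoef x 0)).toAffineMap '' Set.range s := by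
    rw [← Set.range_comp]
    congr 1
    funext i
    exact hs i
  rw [hr, ← AffineSubspace.map_span, htop, ← mem_range_graphIsometry]
  simp

/-- The foot of the perpendicular attains the distance; `abs_mul_cosGraph_le_norm` shows that no
point of the graph is closer. -/
theorem infDist_affineSpan {x : Fin (m + 1) → Euc (m + 1)}
    (hx : simplexDet (fun i => tailPt (x i)) ≠ 0) :
    Metric.infDist 0 (affineSpan ℝ (Set.range x) : Set (Euc (m + 1))) =
      |graphCoef x 0 * cosGraph (tailPt (graphCoef x))| := by
  set p := tailPt (graphCoef x)
  set q := graphCoef x 0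
  have hfoot : graphIsometry p q 0 ∈ affineSpan ℝ (Set.range x) :=
    (mem_affineSpan_range_iff hx _).2 ((mem_range_graphIsometry p q _).1 ⟨0, rfl⟩)
  apply le_antisymm
  · refine (Metric.infDist_le_dist_of_mem hfoot).trans ?_
    rw [dist_zero_left, graphIsometry_apply, ← abs_of_nonneg (norm_nonneg _), ← sq_le_sq,
      norm_sq_graphParam]
    simp
  · refine (Metric.le_infDist ⟨_, hfoot⟩).2 fun z hz => ?_
    have hz' := (mem_affineSpan_range_iff hx z).1 hz
    rw [dist_zero_left, ← consPt_tailPt z, hz']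
    exact abs_mul_cosGraph_le_norm p q (tailPt z)

theorem euclideanHausdorffMeasure_simplex {x : Fin (m + 1) → Euc (m + 1)}
    (hx : simplexDet (fun i => tailPt (x i)) ≠ 0) :
    (Measure.euclideanHausdorffMeasure m).real (convexHull ℝ (Set.range x)) =
      simplexVol (fun i => tailPt (x i)) / cosGraph (tailPt (graphCoef x)) := by
  obtain ⟨s, hs, hv⟩ := exists_graphIsometry_eq hx
  have hr : Set.range x =
      (graphIsometry (tailPt (graphCoef x)) (graphCoef x 0)).toAffineMap '' Set.range s := by
    rw [← Set.range_comp]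
    congr 1
    funext i
    exact hs i
  rw [hv, mul_div_cancel_left₀ _ (cosGraph_pos _).ne', hr, ← AffineMap.image_convexHull,
    simplexVol, Measure.real, Measure.real]
  congr 1
  rw [← EuclideanSpace.euclideanHausdorffMeasure_eq_volume]
  exact (graphIsometry (tailPt (graphCoef x)) (graphCoef x 0)).isometry.euclideanHausdorffMeasure_image _

/-- The linear functional whose level sets are the translates of the graph of `⟪p, ·⟫`. -/
def slopeForm (p : Euc m) : Euc (m + 1) →L[ℝ] ℝ :=
  LinearMap.toContinuousLinearMap
    { toFun := fun z => z 0 - ⟪p, tailPt z⟫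
      map_add' := fun z w => by
        have : tailPt (z + w) = tailPt z + tailPt w := rfl
        rw [this, inner_add_right]; simp; ring
      map_smul' := fun c z => by
        have : tailPt (c • z) = c • tailPt z := rfl
        rw [this, inner_smul_right]; simp; ring }

@[simp] lemma slopeForm_apply (p : Euc m) (z : Euc (m + 1)) :
    slopeForm p z = z 0 - ⟪p, tailPt z⟫ := rfl

/-! ### Exposed faces of a convex hull of points. -/

section Faces

variable {ι E : Type*} [NormedAddCommGroup E] [NormedSpace ℝ E]

/-- The points of a polytope maximising a linear functional are the convex hull of the vertices
maximising it. -/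
lemma convexHull_range_inter_eq {x : ι → E} {l : E →L[ℝ] ℝ} {M : ℝ} (hM : ∀ i, l (x i) ≤ M) :
    {z ∈ convexHull ℝ (Set.range x) | l z = M} = convexHull ℝ (x '' {i | l (x i) = M}) := by
  have hlev : convexHull ℝ (x '' {i | l (x i) = M}) ⊆ {z | l z = M} := by
    refine convexHull_min ?_ (convex_hyperplane l.isLinear M)
    rintro _ ⟨i, hi, rfl⟩
    exact hi
  apply subset_antisymm
  · have hC : Convex ℝ ({z | l z < M} ∪ convexHull ℝ (x '' {i | l (x i) = M})) := by
      rw [convex_iff_forall_pos]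
      have key : ∀ z w : E, l z < M → l w ≤ M → ∀ a b : ℝ, 0 < a → 0 < b → a + b = 1 →
          l (a • z + b • w) < M := by
        intro z w hz hw a b ha hb hab
        have hb' : b = 1 - a := by linarith
        simp only [map_add, map_smul, smul_eq_mul, hb']
        nlinarith
      have hle : ∀ z ∈ ({z | l z < M} ∪ convexHull ℝ (x '' {i | l (x i) = M})), l z ≤ M := by
        rintro z (hz | hz)
        · exact le_of_lt hz
        · exact (hlev hz).le
      intro z hz w hw a b ha hb hab
      rcases hz with hz | hz
      · exact Or.inl (key z w hz (hle w hw) a b ha hb hab)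
      · rcases hw with hw | hw
        · left
          rw [Set.mem_ofPred_eq, add_comm]
          exact key w z hw (hlev hz).le b a hb ha (by linarith)
        · exact Or.inr (convex_convexHull ℝ _ hz hw ha.le hb.le hab)
    have hsub : convexHull ℝ (Set.range x) ⊆
        {z | l z < M} ∪ convexHull ℝ (x '' {i | l (x i) = M}) := by
      refine convexHull_min ?_ hC
      rintro _ ⟨i, rfl⟩
      rcases (hM i).lt_or_eq with h | h
      · exact Or.inl h
      · exact Or.inr (subset_convexHull ℝ _ ⟨i, h, rfl⟩)
    rintro z ⟨hz, hzM⟩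
    rcases hsub hz with h | h
    · exact absurd hzM (ne_of_lt h)
    · exact h
  · exact fun z hz => ⟨convexHull_mono (Set.image_subset_range _ _) hz, hlev hz⟩

lemma isExposed_convexHull_image {x : ι → E} {l : E →L[ℝ] ℝ} {M : ℝ} (hM : ∀ i, l (x i) ≤ M)
    (hne : ∃ i, l (x i) = M) :
    IsExposed ℝ (convexHull ℝ (Set.range x)) (convexHull ℝ (x '' {i | l (x i) = M})) := by
  intro _
  refine ⟨l, ?_⟩
  rw [← convexHull_range_inter_eq hM]
  have hle : ∀ z ∈ convexHull ℝ (Set.range x), l z ≤ M := by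
    refine fun z hz => (convexHull_min ?_ (convex_halfSpace_le l.isLinear M) : _ ⊆ {w | l w ≤ M}) hz
    rintro _ ⟨i, rfl⟩
    exact hM i
  obtain ⟨i, hi⟩ := hne
  ext z
  constructor
  · rintro ⟨hz, hzM⟩
    exact ⟨hz, fun y hy => (hle y hy).trans_eq hzM.symm⟩
  · rintro ⟨hz, hmax⟩
    exact ⟨hz, (hle z hz).antisymm (hi ▸ hmax _ (subset_convexHull ℝ _ ⟨i, rfl⟩))⟩

lemma exists_of_isExposed_convexHull {x : ι → E} {F : Set E} (hF : F.Nonempty)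
    (h : IsExposed ℝ (convexHull ℝ (Set.range x)) F) :
    ∃ (l : E →L[ℝ] ℝ) (M : ℝ), (∀ i, l (x i) ≤ M) ∧
      F = convexHull ℝ (x '' {i | l (x i) = M}) := by
  obtain ⟨l, hl⟩ := h hF
  obtain ⟨z, hz⟩ := hF
  have hz' := hz
  rw [hl] at hz'
  have hM : ∀ i, l (x i) ≤ l z := fun i => hz'.2 _ (subset_convexHull ℝ _ ⟨i, rfl⟩)
  refine ⟨l, l z, hM, ?_⟩
  rw [← convexHull_range_inter_eq hM, hl]
  ext w
  constructor
  · rintro ⟨hw, hmax⟩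
    exact ⟨hw, (hz'.2 w hw).antisymm (hmax z hz'.1)⟩
  · rintro ⟨hw, hwz⟩
    exact ⟨hw, fun y hy => (hz'.2 y hy).trans_eq hwz.symm⟩

lemma vectorSpan_convexHull (s : Set E) : vectorSpan ℝ (convexHull ℝ s) = vectorSpan ℝ s := by
  rw [← direction_affineSpan, affineSpan_convexHull, direction_affineSpan]

end Faces


/-! ### Facets as one-sided index sets. -/

/-- The signed vertical distance of `z` to the hyperplane through the points `x i`. -/
def graphSide (x : Fin (m + 1) → Euc (m + 1)) (z : Euc (m + 1)) : ℝ :=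
  z 0 - (graphCoef x 0 + ⟪tailPt (graphCoef x), tailPt z⟫)

lemma graphSide_eq (x : Fin (m + 1) → Euc (m + 1)) (z : Euc (m + 1)) :
    graphSide x z = slopeForm (tailPt (graphCoef x)) z - graphCoef x 0 := by
  rw [graphSide, slopeForm_apply]; ring

lemma mem_affineSpan_range_iff_graphSide {x : Fin (m + 1) → Euc (m + 1)}
    (hx : simplexDet (fun i => tailPt (x i)) ≠ 0) (z : Euc (m + 1)) :
    z ∈ affineSpan ℝ (Set.range x) ↔ graphSide x z = 0 := by
  rw [mem_affineSpan_range_iff hx, graphSide, sub_eq_zero]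

lemma finrank_vectorSpan_range {x : Fin (m + 1) → Euc (m + 1)}
    (hx : simplexDet (fun i => tailPt (x i)) ≠ 0) :
    Module.finrank ℝ (vectorSpan ℝ (Set.range x)) = m := by
  have h : AffineIndependent ℝ x :=
    AffineIndependent.of_comp ((LinearMap.snd ℝ ℝ (Euc m)).comp
      (consEquiv m).symm.toLinearMap).toAffineMap (affineIndependent_of_simplexDet_ne_zero hx)
  exact h.finrank_vectorSpan (by simp)

/-- A choice of enumeration for every `(m + 1)`-element index set. -/
structure IsEnumeration {n : ℕ} (m : ℕ) (e : Finset (Fin n) → Fin (m + 1) → Fin n) : Prop where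
  injective : ∀ I : Finset (Fin n), I.card = m + 1 → Function.Injective (e I)
  range_eq : ∀ I : Finset (Fin n), I.card = m + 1 → Set.range (e I) = I

lemma exists_isEnumeration {n : ℕ} (m : ℕ) (hn : 0 < n) :
    ∃ e : Finset (Fin n) → Fin (m + 1) → Fin n, IsEnumeration m e := by
  classical
  -- Other cardinalities get the constant value 0, which is never used; it needs an index to exist.
  refine ⟨fun I => if h : I.card = m + 1 then I.orderEmbOfFin h else fun _ => ⟨0, hn⟩, ?_, ?_⟩
  · intro I h
    simp only [h, dite_true]
    exact (I.orderEmbOfFin h).injective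
  · intro I h
    simp [h]

/-- The points are in general position with respect to the first coordinate axis and to each
other. -/
structure GeneralPosition {n : ℕ} (e : Finset (Fin n) → Fin (m + 1) → Fin n)
    (x : Fin n → Euc (m + 1)) : Prop where
  det_ne_zero : ∀ I : Finset (Fin n), I.card = m + 1 → simplexDet (fun i => tailPt (x (e I i))) ≠ 0
  side_ne_zero : ∀ I : Finset (Fin n), I.card = m + 1 →
    ∀ k ∉ I, graphSide (fun i => x (e I i)) (x k) ≠ 0

/-- The points outside `I` lie on one side of the hyperplane through the points of `I`. -/
def OneSided {n : ℕ} (e : Finset (Fin n) → Fin (m + 1) → Fin n)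
    (x : Fin n → Euc (m + 1)) (I : Finset (Fin n)) : Prop :=
  (∀ k ∉ I, graphSide (fun i => x (e I i)) (x k) < 0) ∨
    ∀ k ∉ I, 0 < graphSide (fun i => x (e I i)) (x k)

section Combinatorics

variable {n : ℕ} {e : Finset (Fin n) → Fin (m + 1) → Fin n} {x : Fin n → Euc (m + 1)}

lemma image_eq_range (he : IsEnumeration m e) {I : Finset (Fin n)} (hI : I.card = m + 1) :
    x '' (I : Set (Fin n)) = Set.range fun i => x (e I i) := by
  rw [← he.range_eq I hI, ← Set.range_comp]; rfl

lemma graphSide_eq_zero_iff (he : IsEnumeration m e) (hx : GeneralPosition e x)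
    {I : Finset (Fin n)} (hI : I.card = m + 1) (k : Fin n) :
    graphSide (fun i => x (e I i)) (x k) = 0 ↔ k ∈ I := by
  constructor
  · exact fun h => by_contra fun hk => hx.side_ne_zero I hI k hk h
  · intro hk
    rw [← mem_affineSpan_range_iff_graphSide (hx.det_ne_zero I hI), ← image_eq_range he hI]
    exact subset_affineSpan ℝ _ ⟨k, hk, rfl⟩

/-- Recovers I from its simplex, so that distinct index sets give distinct facets. -/
lemma mem_convexHull_image_iff (he : IsEnumeration m e) (hx : GeneralPosition e x)
    {I : Finset (Fin n)} (hI : I.card = m + 1) (k : Fin n) :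
    x k ∈ convexHull ℝ (x '' (I : Set (Fin n))) ↔ k ∈ I := by
  constructor
  · intro h
    have h' := convexHull_subset_affineSpan _ h
    rw [image_eq_range he hI] at h'
    exact (graphSide_eq_zero_iff he hx hI k).1
      ((mem_affineSpan_range_iff_graphSide (hx.det_ne_zero I hI) _).1 h')
  · exact fun hk => subset_convexHull ℝ _ ⟨k, hk, rfl⟩

lemma finrank_vectorSpan_image (he : IsEnumeration m e) (hx : GeneralPosition e x)
    {I : Finset (Fin n)} (hI : I.card = m + 1) :
    Module.finrank ℝ (vectorSpan ℝ (x '' (I : Set (Fin n)))) = m := by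
  rw [image_eq_range he hI, finrank_vectorSpan_range (hx.det_ne_zero I hI)]

/-- The exposing functional is `slopeForm` or its negative, according to the side. -/
lemma mem_polytopeFaces_of_oneSided (he : IsEnumeration m e) (hx : GeneralPosition e x)
    {I : Finset (Fin n)} (hI : I.card = m + 1) (hside : OneSided e x I) :
    convexHull ℝ (x '' (I : Set (Fin n))) ∈ polytopeFaces m (convexHull ℝ (Set.range x)) := by
  have hne : I.Nonempty := Finset.card_pos.1 (by omega)
  have key : ∀ (l : Euc (m + 1) →L[ℝ] ℝ) (M : ℝ), (∀ k ∈ I, l (x k) = M) →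
      (∀ k ∉ I, l (x k) < M) →
      convexHull ℝ (x '' (I : Set (Fin n))) ∈ polytopeFaces m (convexHull ℝ (Set.range x)) := by
    intro l M h1 h2
    have hset : (I : Set (Fin n)) = {k | l (x k) = M} := by
      ext k
      constructor
      · exact h1 k
      · exact fun hk => by_contra fun hk' => (h2 k hk').ne hk
    refine ⟨?_, ?_, ?_⟩
    · exact (hne.to_set.image x).convexHull
    · rw [hset]
      refine isExposed_convexHull_image (fun k => ?_) ?_
      · by_cases hk : k ∈ I
        · exact (h1 k hk).le
        · exact (h2 k hk).le
      · obtain ⟨k, hk⟩ := hne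
        exact ⟨k, h1 k hk⟩
    · rw [vectorSpan_convexHull, finrank_vectorSpan_image he hx hI]
  have h0 : ∀ k ∈ I, slopeForm (tailPt (graphCoef fun i => x (e I i))) (x k)
      = graphCoef (fun i => x (e I i)) 0 := by
    intro k hk
    have := (graphSide_eq_zero_iff he hx hI k).2 hk
    rw [graphSide_eq] at this
    linarith
  rcases hside with h | h
  · refine key _ _ h0 fun k hk => ?_
    have := h k hk
    rw [graphSide_eq] at this
    linarith
  · refine key (-slopeForm (tailPt (graphCoef fun i => x (e I i)))) (-graphCoef (fun i => x (e I i)) 0)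
      (fun k hk => ?_) fun k hk => ?_
    · have := h0 k hk
      simp only [neg_apply, this]
    · have := h k hk
      rw [graphSide_eq] at this
      simp only [neg_apply]
      linarith

lemma eq_on_affineSpan {s : Set (Euc (m + 1))} {l : Euc (m + 1) →L[ℝ] ℝ} {M : ℝ}
    (hs : ∀ z ∈ s, l z = M) {z : Euc (m + 1)} (hz : z ∈ affineSpan ℝ s) : l z = M := by
  obtain ⟨z₀, hz₀⟩ : s.Nonempty := (affineSpan_nonempty ℝ).1 ⟨z, hz⟩
  have h1 : affineSpan ℝ s ≤ AffineSubspace.mk' z₀ l.ker := by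
    refine affineSpan_le.2 fun w hw => ?_
    rw [SetLike.mem_coe, AffineSubspace.mem_mk']
    simp [hs w hw, hs z₀ hz₀]
  have h2 := h1 hz
  rw [AffineSubspace.mem_mk'] at h2
  have h3 : l (z - z₀) = 0 := h2
  rw [map_sub, hs z₀ hz₀] at h3
  linarith

/-- A facet is the hull of the vertices indexed by some J that maximise a functional l. The
dimension gives at least m + 1 of them, general position at most m + 1. -/
lemma exists_oneSided_of_mem_polytopeFaces (he : IsEnumeration m e) (hx : GeneralPosition e x)
    {F : Set (Euc (m + 1))} (hF : F ∈ polytopeFaces m (convexHull ℝ (Set.range x))) :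
    ∃ I : Finset (Fin n), I.card = m + 1 ∧ OneSided e x I ∧
      F = convexHull ℝ (x '' (I : Set (Fin n))) := by
  classical
  obtain ⟨hne, hexp, hrank⟩ := hF
  obtain ⟨l, M, hM, hFeq⟩ := exists_of_isExposed_convexHull hne hexp
  let J : Finset (Fin n) := Finset.univ.filter fun i => l (x i) = M
  have hJ : (J : Set (Fin n)) = {i | l (x i) = M} := by simp [J]
  rw [← hJ] at hFeq
  have hrankJ : Module.finrank ℝ (vectorSpan ℝ (x '' (J : Set (Fin n)))) = m := by
    rw [← vectorSpan_convexHull, ← hFeq, hrank]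
  have hJne : J.Nonempty := by
    rw [hFeq] at hne
    simpa using hne
  have hcard : m + 1 ≤ J.card := by
    have hpos := Finset.card_pos.2 hJne
    have := finrank_vectorSpan_image_finset_le ℝ x J (n := J.card - 1) (by omega)
    rw [Finset.coe_image, hrankJ] at this
    omega
  obtain ⟨I, hIJ, hI⟩ := Finset.exists_subset_card_eq hcard
  -- Equal dimensions force equal directions, so every point indexed by J lies on the hyperplane
  -- through the points of I, whence J = I.
  have hspan : vectorSpan ℝ (x '' (I : Set (Fin n))) = vectorSpan ℝ (x '' (J : Set (Fin n))) :=
    Submodule.eq_of_le_of_finrank_eq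
      (vectorSpan_mono ℝ (Set.image_mono (Finset.coe_subset.2 hIJ)))
      (by rw [finrank_vectorSpan_image he hx hI, hrankJ])
  obtain ⟨i₀, hi₀⟩ : I.Nonempty := Finset.card_pos.1 (by omega)
  have hJI : J = I := by
    refine (Finset.Subset.antisymm hIJ fun k hk => ?_).symm
    rw [← graphSide_eq_zero_iff he hx hI k, ← mem_affineSpan_range_iff_graphSide
      (hx.det_ne_zero I hI), ← image_eq_range he hI]
    have h1 : x k -ᵥ x i₀ ∈ (affineSpan ℝ (x '' (I : Set (Fin n)))).direction := by
      rw [direction_affineSpan, hspan]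
      exact vsub_mem_vectorSpan ℝ (Set.mem_image_of_mem x hk) (Set.mem_image_of_mem x (hIJ hi₀))
    exact (AffineSubspace.vsub_right_mem_direction_iff_mem
      (subset_affineSpan ℝ _ (Set.mem_image_of_mem x hi₀)) _).1 h1
  rw [hJI] at hFeq hJ
  refine ⟨I, hI, ?_, hFeq⟩
  have hlt : ∀ k ∉ I, l (x k) < M := by
    intro k hk
    refine lt_of_le_of_ne (hM k) fun h => hk ?_
    have : k ∈ (I : Set (Fin n)) := by rw [hJ]; exact h
    exact this
  have hIM : ∀ z ∈ x '' (I : Set (Fin n)), l z = M := by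
    rintro _ ⟨i, hi, rfl⟩
    rw [hJ] at hi
    exact hi
  by_contra hcon
  simp only [OneSided, not_or, not_forall, not_lt] at hcon
  obtain ⟨⟨k, hk, hk1⟩, ⟨j, hj, hj1⟩⟩ := hcon
  set s := graphSide (fun i => x (e I i)) (x k) with hs
  set r := graphSide (fun i => x (e I i)) (x j) with hr
  have hs0 : 0 < s := lt_of_le_of_ne hk1 (hx.side_ne_zero I hI k hk).symm
  have hr0 : r < 0 := lt_of_le_of_ne hj1 (hx.side_ne_zero I hI j hj)
  have hsum : 0 < s - r := by linarith
  -- If `x k` and `x j` were on opposite sides, their segment would cross the hyperplane at w. There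
  -- l equals M, yet w is a convex combination of two points where l is below M. No proportionality
  -- of l to `slopeForm` is needed.
  let w := (-r / (s - r)) • x k + (s / (s - r)) • x j
  have hw0 : graphSide (fun i => x (e I i)) w = 0 := by
    rw [graphSide_eq] at hs hr ⊢
    simp only [w, map_add, map_smul, smul_eq_mul]
    have h1 : slopeForm (tailPt (graphCoef fun i => x (e I i))) (x k)
      = s + graphCoef (fun i => x (e I i)) 0 := by linarith
    have h2 : slopeForm (tailPt (graphCoef fun i => x (e I i))) (x j)
      = r + graphCoef (fun i => x (e I i)) 0 := by linarith
    rw [h1, h2]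
    field_simp
    ring
  have hwM : l w = M := by
    refine eq_on_affineSpan hIM ?_
    rw [image_eq_range he hI]
    exact (mem_affineSpan_range_iff_graphSide (hx.det_ne_zero I hI) w).2 hw0
  have ha : 0 < -r / (s - r) := div_pos (by linarith) hsum
  have hb : 0 < s / (s - r) := div_pos hs0 hsum
  have hab : -r / (s - r) + s / (s - r) = 1 := by field_simp; ring
  have : l w < M := by
    simp only [w, map_add, map_smul, smul_eq_mul]
    calc _ < -r / (s - r) * M + s / (s - r) * M := by
          have := hlt k hk; have := hlt j hj; gcongr
      _ = M := by rw [← add_mul, hab, one_mul]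
  exact this.ne hwM

-- Facets correspond bijectively to one-sided index sets, so the sum over faces becomes a finite sum
-- of measurable weights.
open scoped Classical in
theorem wieackerT_eq_sum (he : IsEnumeration m e) (hx : GeneralPosition e x) (a b : ℝ) :
    wieackerT a b m (convexHull ℝ (Set.range x)) =
      ∑ I ∈ Finset.powersetCard (m + 1) (Finset.univ : Finset (Fin n)),
        if OneSided e x I then
          facetWeight a b (tailPt (graphCoef fun i => x (e I i))) (graphCoef (fun i => x (e I i)) 0)
            (simplexVol fun i => tailPt (x (e I i)))
        else 0 := by
  rw [← Finset.sum_filter]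
  set S := (Finset.powersetCard (m + 1) (Finset.univ : Finset (Fin n))).filter (OneSided e x)
  have hS : ∀ I ∈ S, I.card = m + 1 ∧ OneSided e x I := by
    intro I hI
    simp only [S, Finset.mem_filter, Finset.mem_powersetCard] at hI
    exact ⟨hI.1.2, hI.2⟩
  have hfaces : polytopeFaces m (convexHull ℝ (Set.range x)) =
      (fun I : Finset (Fin n) => convexHull ℝ (x '' (I : Set (Fin n)))) '' (S : Set (Finset (Fin n))) := by
    ext F
    constructor
    · intro hF
      obtain ⟨I, hI, hside, rfl⟩ := exists_oneSided_of_mem_polytopeFaces he hx hF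
      refine ⟨I, ?_, rfl⟩
      simp [S, Finset.mem_powersetCard, hI, hside]
    · rintro ⟨I, hI, rfl⟩
      exact mem_polytopeFaces_of_oneSided he hx (hS I hI).1 (hS I hI).2
  have hinj : Set.InjOn (fun I : Finset (Fin n) => convexHull ℝ (x '' (I : Set (Fin n))))
      (S : Set (Finset (Fin n))) := by
    intro I hI J hJ hIJ
    ext k
    rw [← mem_convexHull_image_iff he hx (hS I hI).1, ← mem_convexHull_image_iff he hx (hS J hJ).1]
    exact Set.ext_iff.1 hIJ (x k)
  rw [wieackerT, hfaces, finsum_mem_image hinj, finsum_mem_coe_finset]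
  refine Finset.sum_congr rfl fun I hI => ?_
  have hdet := hx.det_ne_zero I (hS I hI).1
  rw [affineSpan_convexHull, image_eq_range he (hS I hI).1, infDist_affineSpan hdet,
    euclideanHausdorffMeasure_simplex hdet, facetWeight]

end Combinatorics

/-- The convex hull of at most `m` points has no faces of dimension `m`. -/
lemma wieackerT_eq_zero_of_le {n d : ℕ} (x : Fin n → Euc d) (a b : ℝ) {k : ℕ} (hn : n ≤ k) :
    wieackerT a b k (convexHull ℝ (Set.range x)) = 0 := by
  have hfaces : polytopeFaces k (convexHull ℝ (Set.range x)) = ∅ := by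
    refine Set.eq_empty_of_forall_notMem ?_
    rintro F ⟨⟨z, hz⟩, hexp, hrank⟩
    have hsub : F ⊆ convexHull ℝ (Set.range x) := hexp.subset
    -- At least one point exists since F is nonempty, so n - 1 is a true subtraction; n points span
    -- dimension at most n - 1 < k.
    have hn0 : 0 < n := by
      have : (Set.range x).Nonempty := convexHull_nonempty_iff.1 ⟨z, hsub hz⟩
      obtain ⟨_, i, _⟩ := this
      exact i.pos
    have h1 := Submodule.finrank_mono (vectorSpan_mono ℝ hsub)
    rw [vectorSpan_convexHull, hrank] at h1
    have h2 := finrank_vectorSpan_range_le ℝ x (n := n - 1) (by simp; omega)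
    exact absurd (h1.trans h2) (by omega)
  simp [wieackerT, hfaces]


/-! ### Separating the facet vertices from the other points; general position almost surely. -/

section Split

variable {α : Type*} [MeasurableSpace α] {n r : ℕ}

/-- The index set as the disjoint union of an enumerated part and its complement. -/
def splitEquiv {e : Fin r → Fin n} (he : Function.Injective e) {I : Finset (Fin n)}
    (hI : Set.range e = I) : Fin r ⊕ {k // k ∉ I} ≃ Fin n :=
  (Equiv.sumCongr ((Equiv.ofInjective e he).trans (Equiv.setCongr hI)) (Equiv.refl _)).trans
    (Equiv.sumCompl (· ∈ I))

/-- Integrating out the coordinates outside an index set. -/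
theorem lintegral_pi_split (ν : Fin n → Measure α) [∀ i, SigmaFinite (ν i)] {e : Fin r → Fin n}
    (he : Function.Injective e) {I : Finset (Fin n)} (hI : Set.range e = I)
    {f : (Fin r → α) → ℝ≥0∞} (hf : Measurable f) {g : Fin n → (Fin r → α) → α → ℝ≥0∞}
    (hg : ∀ k, Measurable (Function.uncurry (g k))) :
    ∫⁻ x, f (fun i => x (e i)) * ∏ k ∈ Iᶜ, g k (fun i => x (e i)) (x k) ∂(Measure.pi ν) =
      ∫⁻ u, f u * ∏ k ∈ Iᶜ, ∫⁻ z, g k u z ∂(ν k) ∂(Measure.pi fun i => ν (e i)) := by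
  have hmeas : Measurable fun x : Fin n → α =>
      f (fun i => x (e i)) * ∏ k ∈ Iᶜ, g k (fun i => x (e i)) (x k) := by
    have h1 : Measurable fun (x : Fin n → α) i => x (e i) :=
      measurable_pi_lambda _ fun i => measurable_pi_apply (e i)
    exact (hf.comp h1).mul (Finset.measurable_fun_prod _ fun k _ =>
      (hg k).comp (h1.prodMk (measurable_pi_apply k)))
  have hmp1 := measurePreserving_piCongrLeft ν (splitEquiv he hI)
  have hmp2 := (measurePreserving_sumPiEquivProdPi fun s => ν (splitEquiv he hI s)).symm
  have hmp := hmp1.comp hmp2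
  have hprod : ∀ h : Fin n → ℝ≥0∞, ∏ k ∈ Iᶜ, h k = ∏ k : {k // k ∉ I}, h k := fun h =>
    Finset.prod_subtype Iᶜ (fun k => Finset.mem_compl) h
  have hval : ∀ (u : Fin r → α) (v : {k // k ∉ I} → α) (s : Fin r ⊕ {k // k ∉ I}),
      (MeasurableEquiv.piCongrLeft (fun _ => α) (splitEquiv he hI))
        ((MeasurableEquiv.sumPiEquivProdPi fun _ => α).symm (u, v)) (splitEquiv he hI s) =
      Sum.elim u v s := by
    intro u v s
    rw [MeasurableEquiv.piCongrLeft_apply_apply]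
    cases s <;> rfl
  rw [← hmp.lintegral_comp hmeas]
  refine (lintegral_prod _ (hmeas.comp hmp.measurable).aemeasurable).trans ?_
  refine lintegral_congr fun u => ?_
  have e1 : ∀ v : {k // k ∉ I} → α, (fun i => (MeasurableEquiv.piCongrLeft (fun _ => α)
      (splitEquiv he hI)) ((MeasurableEquiv.sumPiEquivProdPi fun _ => α).symm (u, v)) (e i)) = u :=
    fun v => funext fun i => hval u v (Sum.inl i)
  have e2 : ∀ (v : {k // k ∉ I} → α) (k : {k // k ∉ I}), (MeasurableEquiv.piCongrLeft (fun _ => α)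
      (splitEquiv he hI)) ((MeasurableEquiv.sumPiEquivProdPi fun _ => α).symm (u, v)) k = v k :=
    fun v k => hval u v (Sum.inr k)
  have hgu : ∀ k, Measurable (g k u) := fun k => (hg k).comp (measurable_const.prodMk measurable_id)
  simp only [Function.comp_apply, hprod]
  simp only [e1, e2]
  have hm : Measurable fun v : {k // k ∉ I} → α => ∏ k : {k // k ∉ I}, g k u (v k) :=
    Finset.measurable_fun_prod _ fun k _ => (hgu k).comp (measurable_pi_apply k)
  refine (lintegral_const_mul _ hm).trans ?_
  congr 1
  exact lintegral_fintype_prod (fun k : {k // k ∉ I} => ν k) (fun k => g k u) fun k => hgu k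

end Split

lemma ae_simplexDet_tailPt_ne_zero (γ : Fin (m + 1) → ℝ) :
    ∀ᵐ x ∂(Measure.pi fun i => betaDistribution (m + 1) (γ i)),
      simplexDet (fun i => tailPt (x i)) ≠ 0 := by
  have htail := continuous_tailPt (m := m)
  have hc : Continuous fun x : Fin (m + 1) → Euc (m + 1) => simplexDet fun i => tailPt (x i) := by
    fun_prop
  have hs : MeasurableSet {x : Fin (m + 1) → Euc (m + 1) |
      simplexDet (fun i => tailPt (x i)) = 0} := hc.measurable (measurableSet_singleton 0)
  rw [pi_betaDistribution]
  refine (withDensity_absolutelyContinuous _ _).ae_le ?_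
  change volume {x : Fin (m + 1) → Euc (m + 1) | ¬ simplexDet (fun i => tailPt (x i)) ≠ 0} = 0
  simp only [not_not]
  rw [← lintegral_indicator_one hs, lintegral_tuple_consPt (measurable_one.indicator hs),
    ← lintegral_zero (μ := (volume : Measure (Fin (m + 1) → Euc m)))]
  refine lintegral_congr_ae ?_
  filter_upwards [ae_simplexDet_ne_zero] with t ht
  simp [ht]

lemma measurable_graphSide :
    Measurable fun z : (Fin (m + 1) → Euc (m + 1)) × Euc (m + 1) => graphSide z.1 z.2 := by
  have h1 : Measurable fun z : (Fin (m + 1) → Euc (m + 1)) × Euc (m + 1) => graphCoef z.1 0 :=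
    measurable_graphCoef_zero.comp measurable_fst
  have h2 : Measurable fun z : (Fin (m + 1) → Euc (m + 1)) × Euc (m + 1) =>
      tailPt (graphCoef z.1) := measurable_tailPt_graphCoef.comp measurable_fst
  have h3 : Measurable fun z : (Fin (m + 1) → Euc (m + 1)) × Euc (m + 1) => tailPt z.2 :=
    continuous_tailPt.measurable.comp measurable_snd
  have h4 : Measurable fun z : (Fin (m + 1) → Euc (m + 1)) × Euc (m + 1) => z.2 0 := by fun_prop
  exact h4.sub (h1.add (h2.inner h3))

/-- In the disintegration along parallel hyperplanes, a single hyperplane corresponds to a single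
intercept, a null set. -/
lemma betaDistribution_graph (β : ℝ) (x : Fin (m + 1) → Euc (m + 1)) :
    betaDistribution (m + 1) β {z | graphSide x z = 0} = 0 := by
  have hs : MeasurableSet {z | graphSide x z = 0} :=
    (measurable_graphSide.comp (measurable_const.prodMk measurable_id)) (measurableSet_singleton 0)
  have h := lintegral_height_sub (β := β) (tailPt (graphCoef x))
    (g := ({graphCoef x 0} : Set ℝ).indicator 1)
    (measurable_one.indicator (measurableSet_singleton _))
  rw [← lintegral_indicator_one hs]
  have e1 : ∀ z, ({z | graphSide x z = 0} : Set (Euc (m + 1))).indicator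
      (1 : Euc (m + 1) → ℝ≥0∞) z = ({graphCoef x 0} : Set ℝ).indicator 1
        (z 0 - ⟪tailPt (graphCoef x), tailPt z⟫) := by
    intro z
    have h : graphSide x z = 0 ↔ z 0 - ⟪tailPt (graphCoef x), tailPt z⟫ = graphCoef x 0 := by
      rw [graphSide]
      constructor <;> intro h <;> linarith
    by_cases h0 : graphSide x z = 0
    · simp [h0, h.1 h0]
    · simp [h0, mt h.2 h0]
  simp_rw [e1]
  rw [h, ← lintegral_zero (μ := (volume : Measure ℝ))]
  refine lintegral_congr_ae ?_
  have : ∀ᵐ q : ℝ, q ≠ graphCoef x 0 := compl_mem_ae_iff.2 (measure_singleton _)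
  filter_upwards [this] with q hq
  simp [hq]

variable {n : ℕ} {e : Finset (Fin n) → Fin (m + 1) → Fin n}

theorem ae_generalPosition (he : IsEnumeration m e) {β : Fin n → ℝ} (hβ : ∀ i, -1 < β i) :
    ∀ᵐ x ∂(Measure.pi fun i => betaDistribution (m + 1) (β i)), GeneralPosition e x := by
  have hp : ∀ i, IsProbabilityMeasure (betaDistribution (m + 1) (β i)) :=
    fun i => isProbabilityMeasure_betaDistribution _ (hβ i)
  have htail := continuous_tailPt (m := m)
  have h1 : ∀ᵐ x ∂(Measure.pi fun i => betaDistribution (m + 1) (β i)),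
      ∀ I : Finset (Fin n), I.card = m + 1 → simplexDet (fun i => tailPt (x (e I i))) ≠ 0 := by
    refine ae_all_iff.2 fun I => ?_
    by_cases hI : I.card = m + 1
    swap
    · exact .of_forall fun x h => absurd h hI
    have hc : Continuous fun x : Fin (m + 1) → Euc (m + 1) => simplexDet fun i => tailPt (x i) := by
      fun_prop
    have hs : MeasurableSet {x : Fin (m + 1) → Euc (m + 1) |
      simplexDet (fun i => tailPt (x i)) = 0} := hc.measurable (measurableSet_singleton 0)
    -- Trivial factors outside I reduce the claim to the m + 1 points of I.
    have hsplit := lintegral_pi_split (fun i => betaDistribution (m + 1) (β i)) (he.injective I hI)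
      (he.range_eq I hI) (measurable_one.indicator hs) (g := fun _ _ _ => 1)
      fun _ => measurable_const
    have h0 : ∫⁻ u, ({x : Fin (m + 1) → Euc (m + 1) |
        simplexDet (fun i => tailPt (x i)) = 0}).indicator 1 u
        ∂(Measure.pi fun i => betaDistribution (m + 1) (β (e I i))) = 0 := by
      rw [lintegral_indicator_one hs]
      have := ae_simplexDet_tailPt_ne_zero fun i => β (e I i)
      rw [ae_iff] at this
      simpa using this
    simp only [Finset.prod_const_one, mul_one, lintegral_one, measure_univ, h0] at hsplit
    have hm : Measurable fun x : Fin n → Euc (m + 1) => {x : Fin (m + 1) → Euc (m + 1) |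
        simplexDet (fun i => tailPt (x i)) = 0}.indicator (1 : (Fin (m + 1) → Euc (m + 1)) → ℝ≥0∞)
          (fun i => x (e I i)) :=
      (measurable_one.indicator hs).comp (measurable_pi_lambda _ fun i => measurable_pi_apply (e I i))
    rw [lintegral_eq_zero_iff hm] at hsplit
    filter_upwards [hsplit] with x hx _ hzero
    simp [hzero] at hx
  have h2 : ∀ᵐ x ∂(Measure.pi fun i => betaDistribution (m + 1) (β i)),
      ∀ I : Finset (Fin n), I.card = m + 1 → ∀ k ∉ I, graphSide (fun i => x (e I i)) (x k) ≠ 0 := by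
    refine ae_all_iff.2 fun I => ?_
    by_cases hI : I.card = m + 1
    swap
    · exact .of_forall fun x h => absurd h hI
    suffices h : ∀ k, k ∉ I → ∀ᵐ x ∂(Measure.pi fun i => betaDistribution (m + 1) (β i)),
        graphSide (fun i => x (e I i)) (x k) ≠ 0 by
      have := ae_all_iff.2 fun k => ae_all_iff.2 fun hk => h k hk
      filter_upwards [this] with x hx _ using hx
    intro k hk
    have hs : MeasurableSet {z : (Fin (m + 1) → Euc (m + 1)) × Euc (m + 1) |
      graphSide z.1 z.2 = 0} := measurable_graphSide (measurableSet_singleton 0)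
    -- The factor is the indicator of incidence at j = k and 1 elsewhere; with the points of I
    -- frozen, the k-th integral already vanishes.
    have hg : ∀ j : Fin n, Measurable (Function.uncurry
        (fun (u : Fin (m + 1) → Euc (m + 1)) (z : Euc (m + 1)) => if j = k then
          {z : (Fin (m + 1) → Euc (m + 1)) × Euc (m + 1) |
            graphSide z.1 z.2 = 0}.indicator (1 : _ × _ → ℝ≥0∞) (u, z) else 1)) := by
      intro j
      by_cases hj : j = k
      · simp only [hj, if_true]
        exact measurable_one.indicator hs
      · simp only [hj, if_false]
        exact measurable_const
    have hsplit := lintegral_pi_split (fun i => betaDistribution (m + 1) (β i)) (he.injective I hI)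
      (he.range_eq I hI) (f := fun _ => 1) measurable_const hg
    have h0 : ∀ u : Fin (m + 1) → Euc (m + 1), ∫⁻ z, {z : (Fin (m + 1) → Euc (m + 1)) × Euc (m + 1) |
            graphSide z.1 z.2 = 0}.indicator (1 : _ × _ → ℝ≥0∞) (u, z)
            ∂(betaDistribution (m + 1) (β k)) = 0 := by
      intro u
      have hsu : MeasurableSet {z | graphSide u z = 0} := (measurable_graphSide.comp
        (measurable_const.prodMk measurable_id)) (measurableSet_singleton 0)
      have := betaDistribution_graph (β k) u
      rw [← lintegral_indicator_one hsu] at this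
      exact this
    have h3 : ∀ u : Fin (m + 1) → Euc (m + 1), ∏ j ∈ Iᶜ, ∫⁻ z, (if j = k then
          {z : (Fin (m + 1) → Euc (m + 1)) × Euc (m + 1) |
            graphSide z.1 z.2 = 0}.indicator (1 : _ × _ → ℝ≥0∞) (u, z) else 1)
            ∂(betaDistribution (m + 1) (β j)) = 0 := by
      intro u
      refine Finset.prod_eq_zero (Finset.mem_compl.2 hk) ?_
      simp only [if_true]
      exact h0 u
    simp only [h3, mul_zero, lintegral_zero, one_mul] at hsplit
    have hprod : ∀ x : Fin n → Euc (m + 1), ∏ j ∈ Iᶜ, (if j = k then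
          {z : (Fin (m + 1) → Euc (m + 1)) × Euc (m + 1) |
            graphSide z.1 z.2 = 0}.indicator (1 : _ × _ → ℝ≥0∞) (fun i => x (e I i), x j) else 1)
        = {z : (Fin (m + 1) → Euc (m + 1)) × Euc (m + 1) |
            graphSide z.1 z.2 = 0}.indicator (1 : _ × _ → ℝ≥0∞) (fun i => x (e I i), x k) := by
      intro x
      rw [Finset.prod_eq_single k]
      · simp
      · intro j _ hj; simp [hj]
      · intro h; exact absurd (Finset.mem_compl.2 hk) h
    simp only [hprod] at hsplit
    have hm : Measurable fun x : Fin n → Euc (m + 1) =>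
        {z : (Fin (m + 1) → Euc (m + 1)) × Euc (m + 1) |
          graphSide z.1 z.2 = 0}.indicator (1 : _ × _ → ℝ≥0∞) (fun i => x (e I i), x k) :=
      (measurable_one.indicator hs).comp ((measurable_pi_lambda _ fun i =>
        measurable_pi_apply (e I i)).prodMk (measurable_pi_apply k))
    rw [lintegral_eq_zero_iff hm] at hsplit
    filter_upwards [hsplit] with x hx hzero
    simp [hzero] at hx
  filter_upwards [h1, h2] with x hx1 hx2
  exact ⟨hx1, hx2⟩


/-! ### The expected contribution of one index set. -/

lemma facetWeight_nonneg (a b : ℝ) (p : Euc m) (q : ℝ) {v : ℝ} (hv : 0 ≤ v) :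
    0 ≤ facetWeight a b p q v := by
  have := cosGraph_pos p
  unfold facetWeight
  positivity

lemma IsEnumeration.prod_eq {M : Type*} [CommMonoid M] (he : IsEnumeration m e)
    {I : Finset (Fin n)} (hI : I.card = m + 1) (f : Fin n → M) :
    ∏ i, f (e I i) = ∏ i ∈ I, f i := by
  classical
  have h : Finset.univ.image (e I) = I := by
    rw [← Finset.coe_inj, Finset.coe_image, Finset.coe_univ, Set.image_univ, he.range_eq I hI]
  conv_rhs => rw [← h]
  rw [Finset.prod_image fun i _ j _ hij => he.injective I hI hij]

lemma IsEnumeration.sum_eq {M : Type*} [AddCommMonoid M] (he : IsEnumeration m e)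
    {I : Finset (Fin n)} (hI : I.card = m + 1) (f : Fin n → M) :
    ∑ i, f (e I i) = ∑ i ∈ I, f i := by
  classical
  have h : Finset.univ.image (e I) = I := by
    rw [← Finset.coe_inj, Finset.coe_image, Finset.coe_univ, Set.image_univ, he.range_eq I hI]
  conv_rhs => rw [← h]
  rw [Finset.sum_image fun i _ j _ hij => he.injective I hI hij]

lemma betaVolumeMoment_equiv {ι κ : Type*} [Fintype ι] [Fintype κ] (σ : ι ≃ κ) (γ : κ → ℝ)
    (s : ℝ) : betaVolumeMoment m (fun i => γ (σ i)) s = betaVolumeMoment m γ s := by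
  have hmp := measurePreserving_piCongrLeft (fun k => betaDistribution m (γ k)) σ
  unfold betaVolumeMoment
  rw [← hmp.integral_comp' (g := fun y : κ → Euc m =>
    (volume : Measure (Euc m)).real (convexHull ℝ (Set.range y)) ^ s)]
  refine integral_congr_ae (.of_forall fun y => ?_)
  have h : Set.range (MeasurableEquiv.piCongrLeft (fun _ => Euc m) σ y) = Set.range y := by
    rw [← σ.surjective.range_comp]
    congr 1
    funext i
    exact MeasurableEquiv.piCongrLeft_apply_apply ..
  simp only [h]

lemma IsEnumeration.betaVolumeMoment_eq (he : IsEnumeration m e) {I : Finset (Fin n)}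
    (hI : I.card = m + 1) (β : Fin n → ℝ) (s : ℝ) :
    betaVolumeMoment m (fun i => β (e I i)) s = betaVolumeMoment m (fun i : I => β i) s :=
  betaVolumeMoment_equiv ((Equiv.ofInjective _ (he.injective I hI)).trans
    (Equiv.setCongr (he.range_eq I hI))) (fun i : I => β i) s

lemma betaVolumeMoment_nonneg {ι : Type*} [Fintype ι] (γ : ι → ℝ) (s : ℝ) :
    0 ≤ betaVolumeMoment m γ s :=
  integral_nonneg fun _ => Real.rpow_nonneg measureReal_nonneg _

/-- The weight of the facet spanned by the points indexed by `I`. -/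
def indexWeight (e : Finset (Fin n) → Fin (m + 1) → Fin n) (a b : ℝ) (I : Finset (Fin n))
    (x : Fin n → Euc (m + 1)) : ℝ :=
  facetWeight a b (tailPt (graphCoef fun i => x (e I i))) (graphCoef (fun i => x (e I i)) 0)
    (simplexVol fun i => tailPt (x (e I i)))

lemma indexWeight_nonneg (a b : ℝ) (I : Finset (Fin n)) (x : Fin n → Euc (m + 1)) :
    0 ≤ indexWeight e a b I x := facetWeight_nonneg _ _ _ _ (simplexVol_nonneg _)

/-- The indicator that all signed distances of the points outside `I` lie in `s`. -/
def sideIndicator (e : Finset (Fin n) → Fin (m + 1) → Fin n) (s : Set ℝ) (I : Finset (Fin n))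
    (x : Fin n → Euc (m + 1)) : ℝ≥0∞ :=
  ∏ k ∈ Iᶜ, s.indicator 1 (graphSide (fun i => x (e I i)) (x k))

lemma measurable_indexWeight (a b : ℝ) (I : Finset (Fin n)) :
    Measurable (indexWeight (m := m) e a b I) :=
  (measurable_facetWeight_graphCoef a b).comp
    (measurable_pi_lambda _ fun i => measurable_pi_apply (e I i))

lemma measurable_sideIndicator {s : Set ℝ} (hs : MeasurableSet s) (I : Finset (Fin n)) :
    Measurable (sideIndicator (m := m) e s I) := by
  have h1 : Measurable fun (x : Fin n → Euc (m + 1)) i => x (e I i) :=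
    measurable_pi_lambda _ fun i => measurable_pi_apply (e I i)
  exact Finset.measurable_fun_prod _ fun k _ => (measurable_one.indicator hs).comp
    (measurable_graphSide.comp (h1.prodMk (measurable_pi_apply k)))

lemma sideIndicator_eq_one {s : Set ℝ} {I : Finset (Fin n)} {x : Fin n → Euc (m + 1)}
    (h : ∀ k ∉ I, graphSide (fun i => x (e I i)) (x k) ∈ s) : sideIndicator e s I x = 1 :=
  Finset.prod_eq_one fun k hk => by simp [h k (Finset.mem_compl.1 hk)]

lemma sideIndicator_eq_zero {s : Set ℝ} {I : Finset (Fin n)} {x : Fin n → Euc (m + 1)}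
    (h : ∃ k ∉ I, graphSide (fun i => x (e I i)) (x k) ∉ s) : sideIndicator e s I x = 0 := by
  obtain ⟨k, hk, hks⟩ := h
  exact Finset.prod_eq_zero (Finset.mem_compl.2 hk) (by simp [hks])

open scoped Classical in
-- A point outside I cannot lie on both sides, so the two events are disjoint. For I = univ both
-- would hold vacuously and the weight would appear twice.
lemma ofReal_ite_oneSided {I : Finset (Fin n)} (hI : I ≠ Finset.univ) (x : Fin n → Euc (m + 1))
    (w : ℝ) : ENNReal.ofReal (if OneSided e x I then w else 0) =
      ENNReal.ofReal w * sideIndicator e (Set.Iio 0) I x +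
        ENNReal.ofReal w * sideIndicator e (Set.Ioi 0) I x := by
  obtain ⟨k, hk⟩ : ∃ k, k ∉ I := by
    by_contra! h
    exact hI (Finset.eq_univ_iff_forall.2 h)
  by_cases h1 : ∀ k ∉ I, graphSide (fun i => x (e I i)) (x k) < 0
  · have h2 : sideIndicator e (Set.Ioi 0) I x = 0 :=
      sideIndicator_eq_zero ⟨k, hk, not_lt.2 (h1 k hk).le⟩
    rw [if_pos (show OneSided e x I from Or.inl h1), sideIndicator_eq_one (s := Set.Iio 0) h1, h2,
      mul_one, mul_zero,
      add_zero]
  · have h3 : sideIndicator e (Set.Iio 0) I x = 0 := by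
      push Not at h1
      obtain ⟨j, hj, hj'⟩ := h1
      exact sideIndicator_eq_zero ⟨j, hj, not_lt.2 hj'⟩
    by_cases h2 : ∀ k ∉ I, 0 < graphSide (fun i => x (e I i)) (x k)
    · rw [if_pos (show OneSided e x I from Or.inr h2), sideIndicator_eq_one (s := Set.Ioi 0) h2, h3,
        mul_one, mul_zero,
        zero_add]
    · rw [if_neg (by rintro (h | h); exacts [h1 h, h2 h]), h3]
      push Not at h2
      obtain ⟨j, hj, hj'⟩ := h2
      rw [sideIndicator_eq_zero (s := Set.Ioi 0) ⟨j, hj, not_lt.2 hj'⟩]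
      simp

/-- With the vertices frozen, the other points are independent and lie on the prescribed side with
probabilities depending on the hyperplane only through h = q c. These probabilities form the
function F of `lintegral_facetWeight`. -/
lemma lintegral_indexWeight_sideIndicator (he : IsEnumeration m e) {β : Fin n → ℝ}
    (hβ : ∀ i, -1 < β i) {a b : ℝ} (hb : -1 ≤ b) {I : Finset (Fin n)} (hI : I.card = m + 1)
    {s : Set ℝ} (hs : MeasurableSet s) {Φ : Fin n → ℝ → ℝ≥0∞}
    (hΦ : ∀ k (p : Euc m) q, |q * cosGraph p| < 1 → betaDistribution (m + 1) (β k)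
      {z | z 0 - (q + ⟪p, tailPt z⟫) ∈ s} = Φ k (q * cosGraph p)) :
    ∫⁻ x, ENNReal.ofReal (indexWeight e a b I x) * sideIndicator e s I x
        ∂(Measure.pi fun i => betaDistribution (m + 1) (β i)) =
      ENNReal.ofReal (m.factorial * ((m + 1) / 2 * unitBallVolume (m + 1)) *
          ∏ i ∈ I, (betaConst (m + 1) (β i) / betaConst m (β i))) *
        ENNReal.ofReal (betaVolumeMoment m (fun i : I => β i) (b + 1)) *
        ∫⁻ h in Set.Ioo (-1 : ℝ) 1, ENNReal.ofReal (|h| ^ a * (1 - h ^ 2) ^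
            (∑ i ∈ I, β i + (m : ℝ) / 2 * (m + 1 + b + 1))) * ∏ k ∈ Iᶜ, Φ k h := by
  have hp : ∀ i, IsProbabilityMeasure (betaDistribution (m + 1) (β i)) :=
    fun i => isProbabilityMeasure_betaDistribution _ (hβ i)
  have hmg : ∀ k : Fin n, Measurable (Function.uncurry
      fun (u : Fin (m + 1) → Euc (m + 1)) (z : Euc (m + 1)) =>
        s.indicator (1 : ℝ → ℝ≥0∞) (graphSide u z)) := fun k =>
    (measurable_one.indicator hs).comp measurable_graphSide
  have hsplit := lintegral_pi_split (fun i => betaDistribution (m + 1) (β i)) (he.injective I hI)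
    (he.range_eq I hI) (measurable_facetWeight_graphCoef a b).ennreal_ofReal hmg
  refine hsplit.trans ?_
  have htail := (continuous_tailPt (m := m)).measurable
  have hset : MeasurableSet {z : (Euc m × ℝ) × Euc (m + 1) |
      z.2 0 - (z.1.2 + ⟪z.1.1, tailPt z.2⟫) ∈ s} := by
    have : Measurable fun z : (Euc m × ℝ) × Euc (m + 1) =>
      z.2 0 - (z.1.2 + ⟪z.1.1, tailPt z.2⟫) := by fun_prop
    exact this hs
  have hF : Measurable (Function.uncurry fun (p : Euc m) (q : ℝ) => ∏ k ∈ Iᶜ,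
      betaDistribution (m + 1) (β k) {z | z 0 - (q + ⟪p, tailPt z⟫) ∈ s}) :=
    Finset.measurable_fun_prod _ fun k _ => measurable_measure_prodMk_left hset
  have hmain := lintegral_facetWeight (a := a) (fun i => hβ (e I i)) hb hF
    (g := fun h => ∏ k ∈ Iᶜ, Φ k h) fun p q h => Finset.prod_congr rfl fun k _ => hΦ k p q h
  rw [he.betaVolumeMoment_eq hI β, he.sum_eq hI β,
    he.prod_eq hI fun i => betaConst (m + 1) (β i) / betaConst m (β i)] at hmain
  rw [← hmain]
  refine lintegral_congr fun u => ?_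
  congr 1
  refine Finset.prod_congr rfl fun k _ => ?_
  have hu : MeasurableSet {z | graphSide u z ∈ s} :=
    (measurable_graphSide.comp (measurable_const.prodMk measurable_id)) hs
  change _ = betaDistribution (m + 1) (β k) {z | graphSide u z ∈ s}
  rw [← lintegral_indicator_one hu]
  rfl


/-! ### The integral over the height. -/

lemma integrableOn_one_sub_sq_rpow {γ : ℝ} (hγ : -1 < γ) :
    IntegrableOn (fun h : ℝ => (1 - h ^ 2) ^ γ) (Set.Ioo (-1 : ℝ) 1) := by
  have h := (integrableOn_heightDensity hγ).const_mul (betaConst 1 γ)⁻¹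
  have hc := (betaConst_pos 1 hγ).ne'
  refine h.congr (.of_forall fun x => ?_)
  simp only [heightDensity]
  field_simp

lemma integrableOn_abs_rpow {a : ℝ} (ha : -1 < a) :
    IntegrableOn (fun h : ℝ => |h| ^ a) (Set.Ioo (-1 : ℝ) 1) := by
  have h1 : IntervalIntegrable (fun h : ℝ => |h| ^ a) volume 0 1 := by
    refine (intervalIntegral.intervalIntegrable_rpow' ha).congr ?_
    intro x hx
    rw [Set.uIoc_of_le zero_le_one] at hx
    simp only [abs_of_pos hx.1]
  have h2 : IntervalIntegrable (fun h : ℝ => |h| ^ a) volume (-1) 0 := by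
    have h := (IntervalIntegrable.iff_comp_neg (f := fun h : ℝ => |h| ^ a)).1 h1
    simp only [abs_neg, neg_zero] at h
    exact h.symm
  exact ((intervalIntegrable_iff_integrableOn_Ioo_of_le (by norm_num)).1 (h2.trans h1))

/-- The possible singularities at 0 and at ±1 are separated: for |h| ≤ 1/2 the second factor is
bounded, for |h| ≥ 1/2 the first. -/
lemma integrableOn_abs_rpow_mul {a s : ℝ} (ha : -1 < a) (hs : -1 < s) :
    IntegrableOn (fun h : ℝ => |h| ^ a * (1 - h ^ 2) ^ s) (Set.Ioo (-1 : ℝ) 1) := by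
  have hd := ((integrableOn_abs_rpow ha).const_mul (1 + (3 / 4 : ℝ) ^ s)).add
    ((integrableOn_one_sub_sq_rpow hs).const_mul (1 + (1 / 2 : ℝ) ^ a))
  refine hd.mono' (by fun_prop) ?_
  refine (ae_restrict_iff' measurableSet_Ioo).2 (.of_forall fun h hh => ?_)
  have h0 : 0 < 1 - h ^ 2 := by nlinarith [hh.1, hh.2]
  have h1 : 0 ≤ |h| ^ a := by positivity
  have h2 : 0 ≤ (1 - h ^ 2) ^ s := by positivity
  have h3 : 0 < (3 / 4 : ℝ) ^ s := by positivity
  have h4 : 0 < (1 / 2 : ℝ) ^ a := by positivity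
  have habs : |h| < 1 := abs_lt.2 hh
  rw [Real.norm_of_nonneg (by positivity)]
  simp only [Pi.add_apply]
  rcases le_total |h| (1 / 2) with h5 | h5
  · have h6 : 3 / 4 ≤ 1 - h ^ 2 := by
      rw [← sq_abs]; nlinarith [abs_nonneg h]
    have h7 : (1 - h ^ 2) ^ s ≤ 1 + (3 / 4 : ℝ) ^ s := by
      rcases le_total 0 s with h8 | h8
      · have := Real.rpow_le_one h0.le (by nlinarith [sq_nonneg h]) h8
        linarith
      · have := Real.rpow_le_rpow_of_nonpos (by norm_num) h6 h8
        linarith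
    calc |h| ^ a * (1 - h ^ 2) ^ s ≤ |h| ^ a * (1 + (3 / 4 : ℝ) ^ s) := by gcongr
      _ ≤ _ := by
        have : 0 ≤ (1 + (1 / 2 : ℝ) ^ a) * (1 - h ^ 2) ^ s := by positivity
        linarith
  · have h7 : |h| ^ a ≤ 1 + (1 / 2 : ℝ) ^ a := by
      rcases le_total 0 a with h8 | h8
      · have := Real.rpow_le_one (abs_nonneg h) habs.le h8
        linarith
      · have := Real.rpow_le_rpow_of_nonpos (by norm_num) h5 h8
        linarith
    calc |h| ^ a * (1 - h ^ 2) ^ s ≤ (1 + (1 / 2 : ℝ) ^ a) * (1 - h ^ 2) ^ s := by gcongr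
      _ ≤ _ := by
        have : 0 ≤ (1 + (3 / 4 : ℝ) ^ s) * |h| ^ a := by positivity
        linarith

lemma lintegral_Ioo_comp_neg (g : ℝ → ℝ≥0∞) :
    ∫⁻ h in Set.Ioo (-1 : ℝ) 1, g (-h) = ∫⁻ h in Set.Ioo (-1 : ℝ) 1, g h := by
  rw [← lintegral_indicator measurableSet_Ioo, ← lintegral_indicator measurableSet_Ioo,
    ← lintegral_neg_eq_self ((Set.Ioo (-1 : ℝ) 1).indicator g)]
  refine lintegral_congr fun h => ?_
  have : -h ∈ Set.Ioo (-1 : ℝ) 1 ↔ h ∈ Set.Ioo (-1 : ℝ) 1 := by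
    simp only [Set.mem_Ioo]
    constructor <;> rintro ⟨h1, h2⟩ <;> constructor <;> linarith
  simp only [Set.indicator_apply, this]

lemma lintegral_abs_rpow_mul_betaCDF {n : ℕ} {γ : Fin n → ℝ} (hγ : ∀ i, -1 < γ i) {a s : ℝ}
    (ha : -1 < a) (hs : -1 < s) (J : Finset (Fin n)) :
    ∫⁻ h in Set.Ioo (-1 : ℝ) 1, ENNReal.ofReal (|h| ^ a * (1 - h ^ 2) ^ s) *
        ∏ k ∈ J, ENNReal.ofReal (betaCDF (γ k) h) =
      ENNReal.ofReal (∫ h in (-1 : ℝ)..1, |h| ^ a * (1 - h ^ 2) ^ s * ∏ k ∈ J, betaCDF (γ k) h) := by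
  have hcont : ContinuousOn (fun h => ∏ k ∈ J, betaCDF (γ k) h) (Set.Ioo (-1 : ℝ) 1) :=
    continuousOn_finsetProd _ fun k _ =>
      (continuousOn_betaCDF (hγ k)).mono Set.Ioo_subset_Icc_self
  have h0 : ∀ h ∈ Set.Ioo (-1 : ℝ) 1, ∀ k ∈ J, 0 ≤ betaCDF (γ k) h := fun h hh k _ =>
    betaCDF_nonneg (hγ k) (Set.Ioo_subset_Icc_self hh)
  have hint : IntegrableOn (fun h : ℝ => |h| ^ a * (1 - h ^ 2) ^ s * ∏ k ∈ J, betaCDF (γ k) h)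
      (Set.Ioo (-1 : ℝ) 1) := by
    refine (integrableOn_abs_rpow_mul ha hs).mul_bdd (c := 1)
      (hcont.aestronglyMeasurable measurableSet_Ioo)
      ((ae_restrict_iff' measurableSet_Ioo).2 (.of_forall fun h hh => ?_))
    rw [Real.norm_of_nonneg (Finset.prod_nonneg (h0 h hh))]
    exact Finset.prod_le_one (h0 h hh) fun k _ =>
      betaCDF_le_one (hγ k) (Set.Ioo_subset_Icc_self hh)
  have hnn : ∀ h ∈ Set.Ioo (-1 : ℝ) 1, 0 ≤ |h| ^ a * (1 - h ^ 2) ^ s := by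
    intro h hh
    have h0 : 0 < 1 - h ^ 2 := by nlinarith [hh.1, hh.2]
    positivity
  rw [intervalIntegral.integral_of_le (by norm_num), integral_Ioc_eq_integral_Ioo,
    ofReal_integral_eq_lintegral_ofReal hint ((ae_restrict_iff' measurableSet_Ioo).2
      (.of_forall fun h hh => mul_nonneg (hnn h hh) (Finset.prod_nonneg (h0 h hh))))]
  refine setLIntegral_congr_fun measurableSet_Ioo fun h hh => ?_
  rw [ENNReal.ofReal_mul (hnn h hh), ENNReal.ofReal_prod_of_nonneg (h0 h hh)]

/-- The sum of the two sides doubles one integral, turning m! (m + 1)/2 into (m + 1)!. -/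
theorem lintegral_indexWeight (he : IsEnumeration m e) {β : Fin n → ℝ}
    (hβ : ∀ i, -1 < β i) {a b : ℝ} (ha : -1 < a) (hb : -1 ≤ b) {I : Finset (Fin n)}
    (hI : I.card = m + 1) :
    ∫⁻ x, (ENNReal.ofReal (indexWeight e a b I x) * sideIndicator e (Set.Iio 0) I x +
        ENNReal.ofReal (indexWeight e a b I x) * sideIndicator e (Set.Ioi 0) I x)
        ∂(Measure.pi fun i => betaDistribution (m + 1) (β i)) =
      ENNReal.ofReal ((m + 1).factorial * unitBallVolume (m + 1) *
        (((∏ i ∈ I, betaConst (m + 1) (β i)) / ∏ i ∈ I, betaConst m (β i)) *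
        betaVolumeMoment m (fun i : I => β i) (b + 1) *
        ∫ h in (-1 : ℝ)..1, |h| ^ a * (1 - h ^ 2) ^
          (∑ i ∈ I, β i + (m : ℝ) / 2 * (m + 1 + b + 1)) *
            ∏ k ∈ Iᶜ, betaCDF (β k + (m : ℝ) / 2) h)) := by
  have hm : (0 : ℝ) ≤ m := m.cast_nonneg
  have hγ : ∀ k, -1 < β k + (m : ℝ) / 2 := fun k => by linarith [hβ k]
  -- The sum of the parameters exceeds -(m + 1), and m(m + 1)/2 - m = m(m - 1)/2 ≥ 0 makes up the
  -- difference; b ≥ -1 keeps the remaining term nonnegative.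
  have hs : -1 < ∑ i ∈ I, β i + (m : ℝ) / 2 * (m + 1 + b + 1) := by
    have h1 : -((m : ℝ) + 1) < ∑ i ∈ I, β i := by
      have := Finset.sum_lt_sum_of_nonempty (s := I) (Finset.card_pos.1 (by omega))
        (f := fun _ => (-1 : ℝ)) fun i _ => hβ i
      simpa [hI] using this
    have h2 : 0 ≤ (m : ℝ) * (m - 1) := by
      rcases m.eq_zero_or_pos with h | h
      · simp [h]
      · have : (1 : ℝ) ≤ m := by exact_mod_cast h
        exact mul_nonneg hm (by linarith)
    have h3 : 0 ≤ (m : ℝ) * (b + 1) := mul_nonneg hm (by linarith)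
    linarith
  have hbelow := lintegral_indexWeight_sideIndicator he hβ (a := a) hb hI
    (s := Set.Iio 0) measurableSet_Iio
    (Φ := fun k h => ENNReal.ofReal (betaCDF (β k + (m : ℝ) / 2) h)) fun k p q h => by
      rw [← betaDistribution_below (hβ k) p h.le]
      simp only [Set.mem_Iio, sub_neg]
  have habove := lintegral_indexWeight_sideIndicator he hβ (a := a) hb hI
    (s := Set.Ioi 0) measurableSet_Ioi
    (Φ := fun k h => ENNReal.ofReal (betaCDF (β k + (m : ℝ) / 2) (-h))) fun k p q h => by
      rw [← betaDistribution_above (hβ k) p h.le]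
      simp only [Set.mem_Ioi, sub_pos]
  -- The weight is even in h, so F(-h) may be replaced by F(h).
  have hneg := lintegral_Ioo_comp_neg fun h => ENNReal.ofReal (|h| ^ a * (1 - h ^ 2) ^
      (∑ i ∈ I, β i + (m : ℝ) / 2 * (m + 1 + b + 1))) *
        ∏ k ∈ Iᶜ, ENNReal.ofReal (betaCDF (β k + (m : ℝ) / 2) h)
  simp only [abs_neg, neg_sq] at hneg
  rw [hneg] at habove
  rw [lintegral_abs_rpow_mul_betaCDF hγ ha hs] at hbelow habove
  have hc : ∀ (d : ℕ), 0 < ∏ i ∈ I, betaConst d (β i) := fun d =>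
    Finset.prod_pos fun i _ => betaConst_pos d (hβ i)
  have hM := betaVolumeMoment_nonneg (m := m) (fun i : I => β i) (b + 1)
  have hκ : 0 ≤ unitBallVolume (m + 1) := measureReal_nonneg
  have hq : 0 ≤ (∏ i ∈ I, betaConst (m + 1) (β i)) / ∏ i ∈ I, betaConst m (β i) :=
    div_nonneg (hc _).le (hc _).le
  have hw := (measurable_indexWeight (e := e) (m := m) a b I).ennreal_ofReal
  have hsi := measurable_sideIndicator (e := e) (m := m) (measurableSet_Iio (a := (0 : ℝ))) I
  rw [lintegral_add_left (by fun_prop), hbelow, habove, ← two_mul,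
    Finset.prod_div_distrib, ← ENNReal.ofReal_mul (by positivity),
    ← ENNReal.ofReal_mul (by positivity), ← ENNReal.ofReal_ofNat,
    ← ENNReal.ofReal_mul (by positivity)]
  congr 1
  rw [Nat.factorial_succ]
  push_cast
  ring

/-! ### Assembling the expectation. -/

open scoped Classical in
/-- Almost surely, the functional of the convex hull is a finite sum over index sets. -/
theorem wieackerT_ae_eq (he : IsEnumeration m e) {β : Fin n → ℝ} (hβ : ∀ i, -1 < β i)
    (hn : n ≠ m + 1) (a b : ℝ) :
    ∀ᵐ x ∂(Measure.pi fun i => betaDistribution (m + 1) (β i)),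
      0 ≤ wieackerT a b m (convexHull ℝ (Set.range x)) ∧
      ENNReal.ofReal (wieackerT a b m (convexHull ℝ (Set.range x))) =
        ∑ I ∈ Finset.powersetCard (m + 1) (Finset.univ : Finset (Fin n)),
          (ENNReal.ofReal (indexWeight e a b I x) * sideIndicator e (Set.Iio 0) I x +
            ENNReal.ofReal (indexWeight e a b I x) * sideIndicator e (Set.Ioi 0) I x) := by
  filter_upwards [ae_generalPosition he hβ] with x hx
  rw [wieackerT_eq_sum he hx]
  have h0 : ∀ I ∈ Finset.powersetCard (m + 1) (Finset.univ : Finset (Fin n)),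
      0 ≤ (if OneSided e x I then indexWeight e a b I x else 0) := by
    intro I _
    split_ifs
    · exact indexWeight_nonneg a b I x
    · exact le_rfl
  refine ⟨Finset.sum_nonneg h0, ?_⟩
  refine (ENNReal.ofReal_sum_of_nonneg h0).trans (Finset.sum_congr rfl fun I hI => ?_)
  refine ofReal_ite_oneSided ?_ x _
  -- I = univ would mean n = m + 1, the excluded case.
  rintro rfl
  simp at hI
  exact hn hI

lemma betaTerm_nonneg {β : Fin n → ℝ} (hβ : ∀ i, -1 < β i) (a b : ℝ) (I : Finset (Fin n)) :
    0 ≤ ((∏ i ∈ I, betaConst (m + 1) (β i)) / ∏ i ∈ I, betaConst m (β i)) *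
      betaVolumeMoment m (fun i : I => β i) (b + 1) *
      ∫ h in (-1 : ℝ)..1, |h| ^ a * (1 - h ^ 2) ^
        (∑ i ∈ I, β i + (m : ℝ) / 2 * (m + 1 + b + 1)) *
          ∏ k ∈ Iᶜ, betaCDF (β k + (m : ℝ) / 2) h := by
  have hm : (0 : ℝ) ≤ m := m.cast_nonneg
  have hc : ∀ (d : ℕ), 0 < ∏ i ∈ I, betaConst d (β i) := fun d =>
    Finset.prod_pos fun i _ => betaConst_pos d (hβ i)
  refine mul_nonneg (mul_nonneg (div_nonneg (hc _).le (hc _).le)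
    (betaVolumeMoment_nonneg _ _)) ?_
  refine intervalIntegral.integral_nonneg (by norm_num) fun h hh => ?_
  have h0 : 0 ≤ 1 - h ^ 2 := by nlinarith [hh.1, hh.2]
  exact mul_nonneg (by positivity) (Finset.prod_nonneg fun k _ =>
    betaCDF_nonneg (by linarith [hβ k]) hh)

theorem lintegral_wieackerT (he : IsEnumeration m e) {β : Fin n → ℝ} (hβ : ∀ i, -1 < β i)
    (hn : n ≠ m + 1) {a b : ℝ} (ha : -1 < a) (hb : -1 ≤ b) :
    ∫⁻ x, ENNReal.ofReal (wieackerT a b m (convexHull ℝ (Set.range x)))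
        ∂(Measure.pi fun i => betaDistribution (m + 1) (β i)) =
      ENNReal.ofReal ((m + 1).factorial * unitBallVolume (m + 1) *
        ∑ I ∈ Finset.powersetCard (m + 1) (Finset.univ : Finset (Fin n)),
        (((∏ i ∈ I, betaConst (m + 1) (β i)) / ∏ i ∈ I, betaConst m (β i)) *
        betaVolumeMoment m (fun i : I => β i) (b + 1) *
        ∫ h in (-1 : ℝ)..1, |h| ^ a * (1 - h ^ 2) ^
          (∑ i ∈ I, β i + (m : ℝ) / 2 * (m + 1 + b + 1)) *
            ∏ k ∈ Iᶜ, betaCDF (β k + (m : ℝ) / 2) h)) := by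
  have hκ : 0 ≤ unitBallVolume (m + 1) := measureReal_nonneg
  have hw := fun I => (measurable_indexWeight (e := e) (m := m) a b I).ennreal_ofReal
  have hsi := fun I => measurable_sideIndicator (e := e) (m := m)
    (measurableSet_Iio (a := (0 : ℝ))) I
  have hsi' := fun I => measurable_sideIndicator (e := e) (m := m)
    (measurableSet_Ioi (a := (0 : ℝ))) I
  rw [lintegral_congr_ae ((wieackerT_ae_eq he hβ hn a b).mono fun x hx => hx.2),
    lintegral_finsetSum _ (by fun_prop), Finset.mul_sum,
    ENNReal.ofReal_sum_of_nonneg]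
  · exact Finset.sum_congr rfl fun I hI =>
      lintegral_indexWeight he hβ ha hb (Finset.mem_powersetCard.1 hI).2
  · exact fun I _ => mul_nonneg (by positivity) (betaTerm_nonneg hβ a b I)


/-- The finite sum over index sets is a measurable function agreeing almost surely with the
functional, so measurability of the face structure is never examined directly. -/
lemma aemeasurable_wieackerT (he : IsEnumeration m e) {β : Fin n → ℝ} (hβ : ∀ i, -1 < β i)
    (hn : n ≠ m + 1) (a b : ℝ) :
    AEMeasurable (fun x : Fin n → Euc (m + 1) => wieackerT a b m (convexHull ℝ (Set.range x)))
      (Measure.pi fun i => betaDistribution (m + 1) (β i)) := by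
  have hw := fun I => (measurable_indexWeight (e := e) (m := m) a b I).ennreal_ofReal
  have hsi := fun I => measurable_sideIndicator (e := e) (m := m)
    (measurableSet_Iio (a := (0 : ℝ))) I
  have hsi' := fun I => measurable_sideIndicator (e := e) (m := m)
    (measurableSet_Ioi (a := (0 : ℝ))) I
  refine ⟨fun x => (∑ I ∈ Finset.powersetCard (m + 1) (Finset.univ : Finset (Fin n)),
    (ENNReal.ofReal (indexWeight e a b I x) * sideIndicator e (Set.Iio 0) I x +
      ENNReal.ofReal (indexWeight e a b I x) * sideIndicator e (Set.Ioi 0) I x)).toReal,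
    by fun_prop, ?_⟩
  filter_upwards [wieackerT_ae_eq he hβ hn a b] with x hx
  rw [← hx.2, ENNReal.toReal_ofReal hx.1]

/-- The expectation of `wieackerT` under the joint law of the points. -/
theorem integral_wieackerT_pi {β : Fin n → ℝ} (hβ : ∀ i, -1 < β i)
    (hn : n ≠ m + 1) {a b : ℝ} (ha : -1 < a) (hb : -1 ≤ b) :
    Integrable (fun x : Fin n → Euc (m + 1) => wieackerT a b m (convexHull ℝ (Set.range x)))
      (Measure.pi fun i => betaDistribution (m + 1) (β i)) ∧
    ∫ x, wieackerT a b m (convexHull ℝ (Set.range x))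
        ∂(Measure.pi fun i => betaDistribution (m + 1) (β i)) =
      (m + 1).factorial * unitBallVolume (m + 1) *
        ∑ I ∈ Finset.powersetCard (m + 1) (Finset.univ : Finset (Fin n)),
        (((∏ i ∈ I, betaConst (m + 1) (β i)) / ∏ i ∈ I, betaConst m (β i)) *
        betaVolumeMoment m (fun i : I => β i) (b + 1) *
        ∫ h in (-1 : ℝ)..1, |h| ^ a * (1 - h ^ 2) ^
          (∑ i ∈ I, β i + (m : ℝ) / 2 * (m + 1 + b + 1)) *
            ∏ k ∈ Iᶜ, betaCDF (β k + (m : ℝ) / 2) h) := by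
  rcases Nat.lt_or_ge m n with hmn | hmn
  · obtain ⟨e, he⟩ := exists_isEnumeration m (n := n) (by omega)
    have hmeas := aemeasurable_wieackerT he hβ hn a b
    have hnn := (wieackerT_ae_eq he hβ hn a b).mono fun x hx => hx.1
    have hl := lintegral_wieackerT he hβ hn ha hb
    refine ⟨⟨hmeas.aestronglyMeasurable, ?_⟩, ?_⟩
    · rw [hasFiniteIntegral_iff_ofReal hnn, hl]
      exact ENNReal.ofReal_lt_top
    · rw [integral_eq_lintegral_of_nonneg_ae hnn hmeas.aestronglyMeasurable, hl,
        ENNReal.toReal_ofReal]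
      have hκ : 0 ≤ unitBallVolume (m + 1) := measureReal_nonneg
      exact mul_nonneg (by positivity) (Finset.sum_nonneg fun I _ => betaTerm_nonneg hβ a b I)
  -- With n ≤ m points there are neither facets nor index sets of size m + 1, so both sides vanish.
  · have h0 : ∀ x : Fin n → Euc (m + 1), wieackerT a b m (convexHull ℝ (Set.range x)) = 0 :=
      fun x => wieackerT_eq_zero_of_le x a b hmn
    have hempty : Finset.powersetCard (m + 1) (Finset.univ : Finset (Fin n)) = ∅ :=
      Finset.powersetCard_eq_empty.2 (by simpa using Nat.lt_succ_of_le hmn)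
    simp only [h0, hempty]
    simp

end BetaPolytope
end

theorem theorem2 {Ω : Type*} [MeasurableSpace Ω] (μ : Measure Ω) [IsProbabilityMeasure μ]
    (d n : ℕ) (hd : 1 ≤ d) (hn : n ≠ d) (β : Fin n → ℝ) (hβ : ∀ i, -1 < β i)
    (X : Fin n → Ω → EuclideanSpace ℝ (Fin d))
    (hX : ∀ i, HasLaw (X i) (betaDistribution d (β i)) μ) (hind : iIndepFun X μ)
    (a b : ℝ) (ha : -1 < a) (hb : -1 ≤ b) :
    Integrable (fun ω => wieackerT a b (d - 1) (convexHull ℝ (Set.range fun i => X i ω))) μ ∧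
    ∫ ω, wieackerT a b (d - 1) (convexHull ℝ (Set.range fun i => X i ω)) ∂μ =
      (d.factorial : ℝ) * unitBallVolume d *
        ∑ I ∈ Finset.powersetCard d (Finset.univ : Finset (Fin n)),
          ((∏ i ∈ I, betaConst d (β i)) / ∏ i ∈ I, betaConst (d - 1) (β i)) *
          betaVolumeMoment (d - 1) (fun i : I => β i) (b + 1) *
          ∫ h in (-1 : ℝ)..1,
            |h| ^ a * (1 - h ^ 2) ^ (∑ i ∈ I, β i + ((d : ℝ) - 1) / 2 * ((d : ℝ) + b + 1)) *
              ∏ k ∈ Iᶜ, betaCDF (β k + ((d : ℝ) - 1) / 2) h := by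
  obtain ⟨m, rfl⟩ : ∃ m, d = m + 1 := ⟨d - 1, by omega⟩
  -- Independence and the marginal laws determine the joint law, to which the product-measure
  -- statement applies.
  have hmap : μ.map (fun ω i => X i ω) =
      Measure.pi fun i => betaDistribution (m + 1) (β i) := by
    rw [hind.map_fun_eq_pi_map fun i => (hX i).aemeasurable]
    congr 1
    funext i
    exact (hX i).map_eq
  have haem : AEMeasurable (fun ω i => X i ω) μ :=
    aemeasurable_pi_lambda _ fun i => (hX i).aemeasurable
  obtain ⟨h1, h2⟩ := BetaPolytope.integral_wieackerT_pi hβ hn ha hb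
  rw [← hmap] at h1 h2
  simp only [Nat.add_sub_cancel, Nat.cast_add, Nat.cast_one, add_sub_cancel_right]
  refine ⟨h1.comp_aemeasurable haem, ?_⟩
  rw [← h2, integral_map haem h1.aestronglyMeasurable]
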